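/- Virtual knots are represented by signed Gauss codes (O = over, U = under, followed by the crossing and its sign), modulo change of base point, renaming of crossings and Reidemeister moves. A virtual knot is checkerboard colorable if it has a diagram in which one side of each arc can be marked so that the marking alternates around every classical crossing (arcs pass through virtual crossings unaffected). A crossing is odd if one meets an odd number of classical crossings on a path along the knot from it back to itself; the odd writhe $J$ is the sum of the signs of the odd crossings. The arrow polynomial of a diagram $D$ is $\langle D\rangle_A=\sum_S A^{\alpha-\beta}d^{|S|-1}\langle S\rangle\in\mathbb Z[A^{\pm1},K_1,K_2,\dots]$, $d=-A^2-A^{-2}$, where $S$ runs over the oriented bracket states ($\alpha$, $\beta$ the numbers of smoothings with coefficients $A$, $A^{-1}$), $|S|$ is the number of state circles, and $\langle S\rangle$ is the product of the $K_n$ ($n\ge1$) over the state circles that have $2n$ cusps left after consecutive cusps with insides on the same side are cancelled; $\langle D\rangle_{NA}=(-A^3)^{-\omega(D)}\langle D\rangle_A$ with $\omega$ the writhe. For a polynomial of this kind consider the conditions (1) every summand $A^sK_{i_1}^{j_1}\cdots K_{i_v}^{j_v}$ has even $k$-degree $\sum_t i_tj_t$; (2) every summand $A^sK_{i_1}^{j_1}\cdots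 K_{i_v}^{j_v}$ with $v\ge1$, $i_1<\dots<i_v$, $j_t\ge1$ satisfies $2i_v\le\sum_t i_tj_t$. Consider the following knots of Green's table (given up to reversal and mirror images): 4.55: O1-O2+U1-O3-U4+U3-O4+U2+; 4.56: O1-O2+U1-O3+U4-U3+O4-U2+; 4.59: O1-O2+U1-U3-U2+U4+O3-O4+; 4.72: O1-O2+U1-U3+O4-O3+U2+U4-; 4.76: O1-O2+U1-U3-O4+O3-U4+U2+; 4.77: O1-O2+U1-U3+O4-O3+U4-U2+; 4.93: O1-O2-O3-O4+U1-U3-U2-U4+; 4.96: O1-O2-U3+U1-O4-U2-O3+U4-. **Theorem.** (a) The six virtual knots 4.55, 4.56, 4.59, 4.76, 4.77 and 4.96 are not checkerboard colorable. (b) The normalized arrow polynomials of the diagrams above are $$\langle4.55\rangle_{NA}=A^4+A^{-4}+1-(A^4+A^{-4}+2)K_1^2+2K_2,$$ $$\langle4.56\rangle_{NA}=-A^4(K_1^2-1)+A^{-4}(1-K_1^2)-2K_1^2+2K_2+1,$$ $$\langle4.59\rangle_{NA}=\langle4.76\rangle_{NA}=\langle4.77\rangle_{NA}=A^{-4}\bigl(A^8(K_2-K_1^2)+A^4(3-2K_1^2)-K_1^2+K_2\bigr),$$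 $$\langle4.72\rangle_{NA}=1,\qquad \langle4.96\rangle_{NA}=A^8-A^8K_1^2+K_1^2 .$$ Those of 4.55, 4.56, 4.59, 4.76 and 4.77 violate (2). (c) The diagram of 4.93 has $$\langle4.93\rangle_A=A^{-6}K_1^2+A^4(K_3-K_1K_2)-A^2(K_1^2-1)-K_1K_2+K_1,$$ and $\langle4.93\rangle_{NA}$ violates both (1) and (2); the virtual knot 4.93 is not checkerboard colorable. (d) The virtual knots 2.1, 3.2, 3.3, 3.4, 4.1, 4.3, 4.4, 4.5, 4.7, 4.9, 4.11, 4.14, 4.15, 4.18, 4.20, 4.22, 4.25, 4.27, 4.28, 4.29, 4.30, 4.33, 4.34, 4.37, 4.38, 4.39, 4.40, 4.43, 4.44, 4.45, 4.48, 4.49, 4.52, 4.53, 4.54, 4.60, 4.61, 4.62, 4.63, 4.64, 4.69, 4.73, 4.74, 4.78, 4.80, 4.81, 4.82, 4.83, 4.84, 4.87, 4.88, 4.91, 4.92, 4.94, 4.95, 4.100, 4.101 and 4.104 of Green's table have nonzero odd writhe (on every diagram) and are not checkerboard colorable. (e) Of the seven virtual knots 4.55, 4.56, 4.59, 4.72,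 4.76, 4.77, 4.96, only 4.72 is not settled by (a), and neither criterion applies to it: every diagram of 4.72 has odd writhe $0$, and the polynomial $\langle4.72\rangle_{NA}$ satisfies (1) and (2). -/

import Mathlib

namespace VirtualKnot

/-! ### Gauss diagrams

An oriented virtual knot diagram is recorded by its signed Gauss code: walking once along the knot
one writes down, for every passage through a classical crossing, the crossing, whether one passes
over or under, and the sign of the crossing.  Virtual crossings are not recorded: every Gauss code is
realized by a planar diagram with virtual crossings, and two planar diagrams have the same code
exactly if they differ by detour moves (virtual Reidemeister moves). -/

/-- A passage through a classical crossing. -/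
structure Passage where
  /-- the crossing -/
  label : ℕ
  /-- `true` on the upper strand, `false` on the lower strand -/
  upper : Bool
  /-- the sign of the crossing: `true` for `+1`, `false` for `-1` -/
  pos : Bool
deriving DecidableEq

namespace Passage

/-- The other passage through the same crossing. -/
def mate (x : Passage) : Passage := ⟨x.label, !x.upper, x.pos⟩

/-- The sign of the crossing as an integer. -/
def sign (x : Passage) : ℤ := if x.pos then 1 else -1

/-- The same passage with the crossings renamed. -/
def rename (f : ℕ → ℕ) (x : Passage) : Passage := ⟨f x.label, x.upper, x.pos⟩

end Passage

/-- A list of passages is a Gauss code if every crossing that occurs is passed exactly twice, once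
over and once under, with the same sign. -/
def IsGaussCode (w : List Passage) : Prop :=
  w.Nodup ∧ ∀ x ∈ w, x.mate ∈ w ∧ ∀ y ∈ w, y.label = x.label → y = x ∨ y = x.mate

instance (w : List Passage) : Decidable (IsGaussCode w) :=
  inferInstanceAs (Decidable (_ ∧ _))

/-- A Gauss diagram: a Gauss code, read cyclically, starting at some base point. -/
structure GaussDiagram where
  code : List Passage
  valid : IsGaussCode code

/-! ### Virtual knots -/

/-- The crossing `a` is not used in the code `w`. -/
def Fresh (a : ℕ) (w : List Passage) : Prop := ∀ x ∈ w, x.label ≠ a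

/-- Two consecutive passages, in the given order if `b` is true and in the other order otherwise. -/
def pair (b : Bool) (x y : Passage) : List Passage := if b then [x, y] else [y, x]

/-- The elementary moves on Gauss codes: change of the base point, renaming of the crossings, and the
three Reidemeister moves (for all orientations of the strands). -/
inductive Move : List Passage → List Passage → Prop
  | rotate (u v : List Passage) : Move (u ++ v) (v ++ u)
  | rename (f : ℕ → ℕ) (hf : Function.Injective f) (w : List Passage) :
      Move w (w.map (Passage.rename f))
  /-- First Reidemeister move: a kink with crossing `a` is added. -/
  | reidemeister1 (a : ℕ) (o s : Bool) (w : List Passage) (ha : Fresh a w) :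
      Move w (⟨a, o, s⟩ :: ⟨a, !o, s⟩ :: w)
  /-- Second Reidemeister move: one strand is pushed over another, which creates two crossings
  `a`, `b` of opposite signs; the lower strand meets them in either order (`t`). -/
  | reidemeister2 (a b : ℕ) (s t : Bool) (u v : List Passage) (hab : a ≠ b)
      (ha : Fresh a (u ++ v)) (hb : Fresh b (u ++ v)) :
      Move (u ++ v)
        (pair true ⟨a, true, s⟩ ⟨b, true, !s⟩ ++ u ++ pair t ⟨a, false, s⟩ ⟨b, false, !s⟩ ++ v)
  /-- Third Reidemeister move. The top strand crosses the middle strand at `a` and the bottom strand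
  at `b`, and the middle strand crosses the bottom strand at `c`. On the top strand `a` comes before
  `b` iff `t`, on the middle strand `a` comes before `c` iff `m`, on the bottom strand `b` comes
  before `c` iff `l`. The three strands bound a small triangle in the plane iff the signs satisfy
  `hab`, `hac`; the move reverses the order of the two crossings on each of the strands. In this
  constructor the strands follow each other in the order top, middle, bottom. -/
  | reidemeister3 (a b c : ℕ) (sa sb sc t m l : Bool) (u v w : List Passage)
      (hab : (sa = sb) ↔ (m = l)) (hac : (sa = sc) ↔ (t = l)) :
      Move
        (pair t ⟨a, true, sa⟩ ⟨b, true, sb⟩ ++ u ++ pair m ⟨a, false, sa⟩ ⟨c, true, sc⟩ ++ v ++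
          pair l ⟨b, false, sb⟩ ⟨c, false, sc⟩ ++ w)
        (pair (!t) ⟨a, true, sa⟩ ⟨b, true, sb⟩ ++ u ++ pair (!m) ⟨a, false, sa⟩ ⟨c, true, sc⟩ ++ v ++
          pair (!l) ⟨b, false, sb⟩ ⟨c, false, sc⟩ ++ w)
  /-- The third Reidemeister move with the strands in the order top, bottom, middle. -/
  | reidemeister3' (a b c : ℕ) (sa sb sc t m l : Bool) (u v w : List Passage)
      (hab : (sa = sb) ↔ (m = l)) (hac : (sa = sc) ↔ (t = l)) :
      Move
        (pair t ⟨a, true, sa⟩ ⟨b, true, sb⟩ ++ u ++ pair l ⟨b, false, sb⟩ ⟨c, false, sc⟩ ++ v ++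
          pair m ⟨a, false, sa⟩ ⟨c, true, sc⟩ ++ w)
        (pair (!t) ⟨a, true, sa⟩ ⟨b, true, sb⟩ ++ u ++ pair (!l) ⟨b, false, sb⟩ ⟨c, false, sc⟩ ++ v ++
          pair (!m) ⟨a, false, sa⟩ ⟨c, true, sc⟩ ++ w)

/-- Two Gauss diagrams represent the same virtual knot if they are connected by a finite sequence of
moves and inverse moves. -/
def Equivalent : GaussDiagram → GaussDiagram → Prop :=
  Relation.EqvGen fun D E => Move D.code E.code

/-! ### Arcs and checkerboard colorings

The arcs of a diagram are the pieces of the knot between consecutive classical crossings. An arc is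
named by the passage in which it ends. -/

/-- The passage that follows `x` in the cyclic code `w`; as an arc, the arc that leaves `x`. -/
def next (w : List Passage) (x : Passage) : Passage :=
  w.getD ((w.idxOf x + 1) % w.length) x

/-- The passage that precedes `x` in the cyclic code `w`, where the arc `x` begins. -/
def prev (w : List Passage) (x : Passage) : Passage :=
  w.getD ((w.idxOf x + (w.length - 1)) % w.length) x

/-- Draw the crossing of `x` with both strands directed upwards. `x` lies on the strand that comes in
from the left (and goes out to the right): this is the upper strand at a positive crossing and the
lower strand at a negative crossing. -/
def FromLeft (x : Passage) : Prop := x.upper = x.pos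

instance (x : Passage) : Decidable (FromLeft x) := inferInstanceAs (Decidable (_ = _))

/-- The two sides of a directed curve. -/
inductive Side
  | left
  | right
deriving DecidableEq

open Side in
/-- A coloring marks one side of every arc. It is a checkerboard coloring if it alternates around
every classical crossing: with both strands directed upwards, either the corners on the left and on
the right of the crossing are marked, or those below and above it. (Here `x` is the passage from the
lower left to the upper right, and its mate the one from the lower right to the upper left.)
Arcs run through virtual crossings unaffected. -/
def IsCheckerboardColoring (D : GaussDiagram) (c : Passage → Side) : Prop :=
  ∀ x ∈ D.code, FromLeft x →
    (c x = left ∧ c x.mate = right ∧ c (next D.code x.mate) = left ∧ c (next D.code x) = right) ∨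
    (c x = right ∧ c x.mate = left ∧ c (next D.code x.mate) = right ∧ c (next D.code x) = left)

/-- The diagram is checkerboard colorable. -/
def DiagramColorable (D : GaussDiagram) : Prop := ∃ c, IsCheckerboardColoring D c

/-- The virtual knot represented by `D` is checkerboard colorable: it has a checkerboard colorable
diagram. -/
def KnotColorable (D : GaussDiagram) : Prop := ∃ E, Equivalent D E ∧ DiagramColorable E

/-! ### Odd writhe -/

/-- The number of classical crossings (passages) that one meets walking along the knot from the
crossing of `x`, starting at `x`, until one first returns to that crossing. -/
def encountered (w : List Passage) (x : Passage) : ℕ :=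
  (w.idxOf x.mate + (w.length - w.idxOf x)) % w.length - 1

/-- The odd writhe: the sum of the signs of the odd crossings. -/
def oddWrithe (D : GaussDiagram) : ℤ :=
  ((D.code.filter fun x => x.upper ∧ Odd (encountered D.code x)).map Passage.sign).sum

/-- The writhe: the sum of the signs of all classical crossings. -/
def writhe (D : GaussDiagram) : ℤ :=
  ((D.code.filter fun x => x.upper).map Passage.sign).sum

/-! ### Arrow polynomial

A state is given by the set `S` of those crossings that are smoothed with coefficient `A`; the other
crossings are smoothed with coefficient `A⁻¹`. At a positive crossing the `A`-smoothing is the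
oriented one, at a negative crossing it is the disoriented one. -/

/-- The set of classical crossings of a code. -/
def crossings (w : List Passage) : Finset ℕ := (w.map Passage.label).toFinset

/-- The crossing of `x` has the oriented smoothing in the state `S`. -/
def OrientedAt (S : Finset ℕ) (x : Passage) : Prop := (x.label ∈ S) ↔ (x.pos = true)

instance (S : Finset ℕ) (x : Passage) : Decidable (OrientedAt S x) :=
  inferInstanceAs (Decidable (_ ↔ _))

/-- One step along a state circle. We are on the arc `p.1` and traverse it in the direction of the
knot if `p.2` is true, and against it otherwise. Arriving at a crossing with oriented smoothing, we
change to the other strand and keep the direction; at a disoriented smoothing we change to the other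
strand and reverse the direction, turning from an incoming arc to the other incoming arc, or from an
outgoing arc to the other outgoing arc. -/
def step (w : List Passage) (S : Finset ℕ) (p : Passage × Bool) : Passage × Bool :=
  if p.2 then
    if OrientedAt S p.1 then (next w p.1.mate, true) else (p.1.mate, false)
  else
    if OrientedAt S (prev w p.1) then ((prev w p.1).mate, false)
    else (next w (prev w p.1).mate, true)

/-- The cusp, if any, at the crossing where `p` arrives, given by the side on which its inside (the
acute angle) lies as we turn. With both strands of the crossing directed upwards, the two cusps of a
disoriented smoothing open downwards (between the incoming arcs) and upwards (between the outgoing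
arcs). Turning from the lower left to the lower right, or from the upper right to the upper left, we
have the inside on the right, and otherwise on the left; in the first two cases we arrive on the
strand that comes in from the left. -/
def cusp (w : List Passage) (S : Finset ℕ) (p : Passage × Bool) : Option Side :=
  let x := if p.2 then p.1 else prev w p.1
  if OrientedAt S x then none else if FromLeft x then some Side.right else some Side.left

/-- The sequence `p, step p, step (step p), …` up to the last term before it returns to `q`, cut off
after `n + 1` terms. -/
def walk (w : List Passage) (S : Finset ℕ) (q : Passage × Bool) :
    ℕ → Passage × Bool → List (Passage × Bool)
  | 0, p => [p]
  | n + 1, p => p :: if step w S p = q then [] else walk w S q n (step w S p)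

/-- The state circle through the arc `x`, starting along `x` in the direction of the knot. (A state
circle runs through every arc at most once, so that the cut-off is not reached.) -/
def circle (w : List Passage) (S : Finset ℕ) (x : Passage) : List (Passage × Bool) :=
  walk w S (x, true) w.length (x, true)

/-- Cancellation of consecutive cusps whose insides lie on the same side. -/
def reduceCusps : List Side → List Side
  | [] => []
  | s :: l => match reduceCusps l with
    | [] => [s]
    | t :: r => if s = t then r else s :: t :: r

/-- The state circle through the arc `x` reduces to the circle graph `K_n` with `2 n` cusps of
alternating types, where `n` is the value of this function; `n = 0` means the circle without cusps.
(The number of cusps of a state circle is even. Hence a word without equal consecutive letters that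
is left over has different first and last letters and is reduced cyclically, too.) -/
def arrowIndex (w : List Passage) (S : Finset ℕ) (x : Passage) : ℕ :=
  (reduceCusps ((circle w S x).filterMap (cusp w S))).length / 2

/-- The state circles of the state `S`: every circle, as its set of arcs, with the index of the
reduced circle graph. -/
def stateCircles (w : List Passage) (S : Finset ℕ) : Finset (Finset Passage × ℕ) :=
  w.toFinset.image fun x => (((circle w S x).map Prod.fst).toFinset, arrowIndex w S x)

/-- The ring of polynomials in `K_1, K_2, …` over the ring of integral Laurent polynomials in `A`. -/
abbrev ArrowRing : Type := MvPolynomial ℕ+ (LaurentPolynomial ℤ)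

/-- The power `A ^ k`. -/
noncomputable def A (k : ℤ) : ArrowRing := MvPolynomial.C (LaurentPolynomial.T k)

/-- The variable `K_n` for `n ≥ 1`, and `K_0 = 1`. -/
noncomputable def K (n : ℕ) : ArrowRing :=
  if h : 0 < n then MvPolynomial.X ⟨n, h⟩ else 1

/-- The value `d = - A ^ 2 - A ^ (-2)` of a circle. -/
noncomputable def loopValue : ArrowRing := -A 2 - A (-2)

/-- The arrow polynomial `∑_S A ^ (α - β) d ^ (|S| - 1) ⟨S⟩` of a diagram. (For the diagram without
crossings there is no arc and hence `stateCircles` is empty; the value is `1`, as it should be for a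
single circle.) -/
noncomputable def arrowPolynomial (D : GaussDiagram) : ArrowRing :=
  ∑ S ∈ (crossings D.code).powerset,
    A ((S.card : ℤ) - ((crossings D.code \ S).card : ℤ)) *
      loopValue ^ ((stateCircles D.code S).card - 1) *
        ∏ p ∈ stateCircles D.code S, K p.2

/-- The normalized arrow polynomial `(- A ^ 3) ^ (- writhe) ⟨D⟩`. -/
noncomputable def normalizedArrowPolynomial (D : GaussDiagram) : ArrowRing :=
  (-1) ^ (writhe D).natAbs * A (-3 * writhe D) * arrowPolynomial D

/-- The `k`-degree `i_1 j_1 + ⋯ + i_v j_v` of a summand `A ^ s K_{i_1} ^ {j_1} ⋯ K_{i_v} ^ {j_v}`. -/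
def kDegree (m : ℕ+ →₀ ℕ) : ℕ := m.sum fun i j => (i : ℕ) * j

/-- All summands have even `k`-degree. -/
def EvenKDegrees (p : ArrowRing) : Prop := ∀ m ∈ p.support, Even (kDegree m)

/-- Every summand `A ^ s K_{i_1} ^ {j_1} ⋯ K_{i_v} ^ {j_v}` with `v ≥ 1` and `i_1 < ⋯ < i_v` satisfies
`2 i_v ≤ i_1 j_1 + ⋯ + i_v j_v`. -/
def LargestIndexBound (p : ArrowRing) : Prop :=
  ∀ m ∈ p.support, ∀ i ∈ m.support, 2 * (i : ℕ) ≤ kDegree m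

/-! ### The virtual knots from Green's table -/

/-- The code with the given sequence of passages, where `k` and `-k` stand for passing over and under
the crossing `k = 1, 2, …`, and the given list of the signs of the crossings `1, 2, …`. -/
def word (seq signs : List ℤ) : List Passage :=
  seq.map fun k => ⟨k.natAbs, 0 < k, 0 < signs.getD (k.natAbs - 1) 0⟩

/-- The Gauss diagram with the given data. -/
def ofData (seq signs : List ℤ) (h : IsGaussCode (word seq signs) := by decide) : GaussDiagram :=
  ⟨word seq signs, h⟩

def knot4_55 : GaussDiagram := ofData [1, 2, -1, 3, -4, -3, 4, -2] [-1, 1, -1, 1]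

def knot4_56 : GaussDiagram := ofData [1, 2, -1, 3, -4, -3, 4, -2] [-1, 1, 1, -1]

def knot4_59 : GaussDiagram := ofData [1, 2, -1, -3, -2, -4, 3, 4] [-1, 1, -1, 1]

def knot4_72 : GaussDiagram := ofData [1, 2, -1, -3, 4, 3, -2, -4] [-1, 1, 1, -1]

def knot4_76 : GaussDiagram := ofData [1, 2, -1, -3, 4, 3, -4, -2] [-1, 1, -1, 1]

def knot4_77 : GaussDiagram := ofData [1, 2, -1, -3, 4, 3, -4, -2] [-1, 1, 1, -1]

def knot4_93 : GaussDiagram := ofData [1, 2, 3, 4, -1, -3, -2, -4] [-1, -1, -1, 1]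

def knot4_96 : GaussDiagram := ofData [1, 2, -3, -1, 4, -2, 3, -4] [-1, -1, 1, -1]

/-- The knots 2.1, 3.2, 3.3, 3.4, 4.1, 4.3, 4.4, 4.5, 4.7, 4.9, 4.11, 4.14, 4.15, 4.18, 4.20, 4.22,
4.25, 4.27, 4.28, 4.29, 4.30, 4.33, 4.34, 4.37, 4.38, 4.39, 4.40, 4.43, 4.44, 4.45, 4.48, 4.49, 4.52,
4.53, 4.54, 4.60, 4.61, 4.62, 4.63, 4.64, 4.69, 4.73, 4.74, 4.78, 4.80, 4.81, 4.82, 4.83, 4.84, 4.87,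
4.88, 4.91, 4.92, 4.94, 4.95, 4.100, 4.101, 4.104 of Green's table, in this order. -/
def oddWritheKnots : List GaussDiagram :=
  [ /- 2.1 -/ ofData [1, 2, -1, -2] [-1, -1],
    /- 3.2 -/ ofData [1, 2, -1, 3, -2, -3] [-1, 1, -1],
    /- 3.3 -/ ofData [1, 2, -1, -3, -2, 3] [-1, -1, -1],
    /- 3.4 -/ ofData [1, 2, -1, -3, -2, 3] [-1, 1, -1],
    /- 4.1 -/ ofData [1, 2, -1, -2, 3, 4, -3, -4] [-1, -1, -1, -1],
    /- 4.3 -/ ofData [1, 2, -1, -2, 3, -4, -3, 4] [-1, -1, -1, -1],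
    /- 4.4 -/ ofData [1, 2, -1, -2, 3, -4, -3, 4] [-1, -1, -1, 1],
    /- 4.5 -/ ofData [1, 2, -1, -2, 3, -4, -3, 4] [-1, -1, 1, -1],
    /- 4.7 -/ ofData [1, 2, -1, -2, -3, -4, 3, 4] [-1, -1, -1, -1],
    /- 4.9 -/ ofData [1, 2, -1, 3, -2, 4, -3, -4] [-1, -1, -1, -1],
    /- 4.11 -/ ofData [1, 2, -1, 3, -2, 4, -3, -4] [-1, -1, 1, -1],
    /- 4.14 -/ ofData [1, 2, -1, 3, -2, 4, -3, -4] [-1, 1, 1, -1],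
    /- 4.15 -/ ofData [1, 2, -1, 3, -2, -4, -3, 4] [-1, -1, -1, -1],
    /- 4.18 -/ ofData [1, 2, -1, 3, -2, -4, -3, 4] [-1, 1, -1, -1],
    /- 4.20 -/ ofData [1, 2, -1, 3, -2, -4, -3, 4] [-1, 1, 1, -1],
    /- 4.22 -/ ofData [1, 2, -1, 3, 4, -2, -3, -4] [-1, -1, 1, 1],
    /- 4.25 -/ ofData [1, 2, -1, 3, 4, -2, -4, -3] [-1, -1, -1, -1],
    /- 4.27 -/ ofData [1, 2, -1, 3, 4, -2, -4, -3] [-1, 1, -1, -1],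
    /- 4.28 -/ ofData [1, 2, -1, 3, 4, -2, -4, -3] [-1, 1, 1, 1],
    /- 4.29 -/ ofData [1, 2, -1, 3, 4, -3, -2, -4] [-1, -1, -1, -1],
    /- 4.30 -/ ofData [1, 2, -1, 3, 4, -3, -2, -4] [-1, -1, -1, 1],
    /- 4.33 -/ ofData [1, 2, -1, 3, 4, -3, -2, -4] [-1, 1, -1, -1],
    /- 4.34 -/ ofData [1, 2, -1, 3, 4, -3, -2, -4] [-1, 1, -1, 1],
    /- 4.37 -/ ofData [1, 2, -1, 3, -4, -2, -3, 4] [-1, -1, -1, -1],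
    /- 4.38 -/ ofData [1, 2, -1, 3, -4, -2, -3, 4] [-1, -1, -1, 1],
    /- 4.39 -/ ofData [1, 2, -1, 3, -4, -2, -3, 4] [-1, -1, 1, -1],
    /- 4.40 -/ ofData [1, 2, -1, 3, -4, -2, -3, 4] [-1, -1, 1, 1],
    /- 4.43 -/ ofData [1, 2, -1, 3, -4, -2, 4, -3] [-1, -1, -1, -1],
    /- 4.44 -/ ofData [1, 2, -1, 3, -4, -2, 4, -3] [-1, -1, -1, 1],
    /- 4.45 -/ ofData [1, 2, -1, 3, -4, -2, 4, -3] [-1, -1, 1, -1],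
    /- 4.48 -/ ofData [1, 2, -1, 3, -4, -3, -2, 4] [-1, -1, -1, -1],
    /- 4.49 -/ ofData [1, 2, -1, 3, -4, -3, -2, 4] [-1, -1, -1, 1],
    /- 4.52 -/ ofData [1, 2, -1, 3, -4, -3, -2, 4] [-1, 1, -1, 1],
    /- 4.53 -/ ofData [1, 2, -1, 3, -4, -3, 4, -2] [-1, -1, -1, -1],
    /- 4.54 -/ ofData [1, 2, -1, 3, -4, -3, 4, -2] [-1, -1, -1, 1],
    /- 4.60 -/ ofData [1, 2, -1, -3, -2, -4, 3, 4] [-1, 1, 1, -1],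
    /- 4.61 -/ ofData [1, 2, -1, -3, 4, -2, 3, -4] [-1, -1, -1, -1],
    /- 4.62 -/ ofData [1, 2, -1, -3, 4, -2, 3, -4] [-1, -1, -1, 1],
    /- 4.63 -/ ofData [1, 2, -1, -3, 4, -2, 3, -4] [-1, -1, 1, -1],
    /- 4.64 -/ ofData [1, 2, -1, -3, 4, -2, 3, -4] [-1, -1, 1, 1],
    /- 4.69 -/ ofData [1, 2, -1, -3, 4, 3, -2, -4] [-1, -1, -1, -1],
    /- 4.73 -/ ofData [1, 2, -1, -3, 4, 3, -4, -2] [-1, -1, -1, -1],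
    /- 4.74 -/ ofData [1, 2, -1, -3, 4, 3, -4, -2] [-1, -1, -1, 1],
    /- 4.78 -/ ofData [1, 2, -1, -3, -4, -2, 3, 4] [-1, -1, -1, -1],
    /- 4.80 -/ ofData [1, 2, -1, -3, -4, -2, 4, 3] [-1, -1, -1, -1],
    /- 4.81 -/ ofData [1, 2, -1, -3, -4, -2, 4, 3] [-1, 1, -1, -1],
    /- 4.82 -/ ofData [1, 2, 3, -1, 4, -2, -3, -4] [-1, -1, -1, -1],
    /- 4.83 -/ ofData [1, 2, 3, -1, 4, -2, -3, -4] [-1, -1, -1, 1],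
    /- 4.84 -/ ofData [1, 2, 3, -1, 4, -2, -3, -4] [-1, 1, 1, -1],
    /- 4.87 -/ ofData [1, 2, 3, -1, -4, -2, -3, 4] [-1, -1, -1, -1],
    /- 4.88 -/ ofData [1, 2, 3, -1, -4, -2, -3, 4] [-1, 1, 1, -1],
    /- 4.91 -/ ofData [1, 2, 3, 4, -1, -2, -3, -4] [-1, -1, -1, -1],
    /- 4.92 -/ ofData [1, 2, 3, 4, -1, -3, -2, -4] [-1, -1, -1, -1],
    /- 4.94 -/ ofData [1, 2, -3, -1, 4, -2, 3, -4] [-1, -1, -1, -1],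
    /- 4.95 -/ ofData [1, 2, -3, -1, 4, -2, 3, -4] [-1, -1, -1, 1],
    /- 4.100 -/ ofData [1, 2, -3, 4, -1, -2, 3, -4] [-1, -1, -1, -1],
    /- 4.101 -/ ofData [1, 2, -3, 4, -1, -2, 3, -4] [-1, -1, -1, 1],
    /- 4.104 -/ ofData [1, 2, -3, 4, -2, -1, 3, -4] [-1, -1, 1, 1]]

end VirtualKnot

/-! Non-colorability comes from parity. Going along a checkerboard colorable diagram, the marked
side flips at every classical crossing, and the two arcs that enter a crossing are marked on
opposite sides; so the two passages of a crossing occupy positions of opposite parity, and every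
crossing is even (`DiagramColorable.not_isOddAt`). Deleting all odd crossings turns each
Reidemeister move into the same kind of move or into nothing, and the signs of the deleted crossings
have an invariant sum (`parityInvariant_move`). Hence the odd writhe is an invariant that vanishes
on colorable knots, which settles the long list of knots in (d).

For the knots with odd writhe zero the deletion itself is the obstruction. It fixes a colorable
diagram, so a colorable knot must have the same invariants before and after any number of deletions
(`KnotColorable.coloring`). The invariant used is the set of colorings by a finite biquandle, whose
invariance under all moves is `Biquandle.coloring_move`. Repeated deletion trivializes 4.55, 4.56,
4.59, 4.76 and 4.77 completely, and a code without crossings has exactly as many colorings as the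
biquandle has elements; a list with one coloring more is exhibited for each knot. Deletion leaves
only kinks of 4.93 and 4.96; what is left has a coloring by `biquandle4'`, while the knots
themselves have none.

The arrow polynomials are independent of this: a diagram with four crossings has sixteen states,
which are evaluated by the kernel and summed in the polynomial ring. Violations of (1) and (2) are
read off from the coefficient of a single variable `K i` with `i ≠ 1`. The polynomial criteria are
never used to prove non-colorability. -/

namespace VirtualKnot

/-! ### Biquandle colorings -/

/-- A biquandle, presented by the colors of the four arcs at a crossing in terms of a state
`z : X × X` of the crossing. Each of the two strands of a crossing has an arc on either side of the
other strand; `upper i z` and `lower i z` are the colors of the upper and the lower arcs. -/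
structure Biquandle (X : Type) where
  upper : Bool → X × X → X
  lower : Bool → X × X → X
  -- Any one upper and any one lower arc determine the whole crossing. This includes the sideways
  -- pairs, which are needed for the second move with either direction of the lower strand.
  solve : Bool → Bool → X → X → X × X
  kinkSolve : Bool → X → X × X
  upper_solve : ∀ i j x y, upper i (solve i j x y) = x
  lower_solve : ∀ i j x y, lower j (solve i j x y) = y
  solve_eq : ∀ i j z, solve i j (upper i z) (lower j z) = z
  -- If the small loop of a kink closes up, its two outer ends have equal colors. By the next
  -- fields, an upper arc of a kink may have any color and determines the state.
  kink : ∀ z, upper true z = lower false z ↔ upper false z = lower true z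
  upper_kinkSolve : ∀ i x, upper i (kinkSolve i x) = x
  kinkSolve_kink : ∀ i x, upper true (kinkSolve i x) = lower false (kinkSolve i x)
  kinkSolve_eq : ∀ i z, upper true z = lower false z → kinkSolve i (upper i z) = z
  -- The set-theoretic Yang–Baxter equation for all orientations at once. The state `za` and the
  -- color `y` of the inner arc of the bottom strand determine the triangle. The primed states are
  -- solved from the colors at the six ends, and the condition is that their three inner arcs fit
  -- again.
  triangle : ∀ i j k za y,
    let zb := solve (!k) j (upper i za) y
    let zc := solve (!k) (!i) (lower j za) y
    let za' := solve i j (upper k zb) (upper k zc)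
    let zb' := solve (!k) j (upper (!i) za) (lower i zc)
    let zc' := solve (!k) (!i) (lower (!j) za) (lower (!j) zb)
    upper (!i) za' = upper k zb' ∧ lower (!j) za' = upper k zc' ∧ lower (!j) zb' = lower i zc'

namespace Biquandle

variable {X : Type} (B : Biquandle X)

/-- The color of the arc on side `i` of the upper (`o = true`) or the lower strand. -/
def arc (o i : Bool) (z : X × X) : X := if o then B.upper i z else B.lower i z

@[simp] theorem arc_true (i : Bool) (z : X × X) : B.arc true i z = B.upper i z := rfl

@[simp] theorem arc_false (i : Bool) (z : X × X) : B.arc false i z = B.lower i z := rfl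

theorem ext_of_arc {i j : Bool} {z z' : X × X} (h : B.upper i z = B.upper i z')
    (h' : B.lower j z = B.lower j z') : z = z' := by
  rw [← B.solve_eq i j z, h, h', B.solve_eq]

/-- The states of the three crossings before and after a third Reidemeister move have the same colors
at the six ends of the strands. -/
def SameEnds (i j k : Bool) (za zb zc za' zb' zc' : X × X) : Prop :=
  (B.upper (!k) zb' = B.upper (!i) za ∧ B.upper i za' = B.upper k zb) ∧
  (B.upper (!k) zc' = B.lower (!j) za ∧ B.lower j za' = B.upper k zc) ∧
  (B.lower (!i) zc' = B.lower (!j) zb ∧ B.lower j zb' = B.lower i zc)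

/-- The colors of the three arcs that bound the triangle fit. -/
def Fits (i j k : Bool) (za zb zc : X × X) : Prop :=
  B.upper i za = B.upper (!k) zb ∧ B.lower j za = B.upper (!k) zc ∧ B.lower j zb = B.lower (!i) zc

theorem SameEnds.symm {i j k : Bool} {za zb zc za' zb' zc' : X × X}
    (h : B.SameEnds i j k za zb zc za' zb' zc') :
    B.SameEnds (!i) (!j) (!k) za' zb' zc' za zb zc := by
  simp only [SameEnds, Bool.not_not] at *
  exact ⟨⟨h.1.2.symm, h.1.1.symm⟩, ⟨h.2.1.2.symm, h.2.1.1.symm⟩, ⟨h.2.2.2.symm, h.2.2.1.symm⟩⟩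

/-- Since the inner arcs fit, `zb` and `zc` are the states that the `triangle` field solves for,
with `y` the inner arc of the bottom strand. -/
theorem exists_sameEnds {i j k : Bool} {za zb zc : X × X} (h : B.Fits i j k za zb zc) :
    ∃ za' zb' zc', B.Fits (!i) (!j) (!k) za' zb' zc' ∧ B.SameEnds i j k za zb zc za' zb' zc' := by
  obtain ⟨h1, h2, h3⟩ := h
  have t := B.triangle i j k za (B.lower j zb)
  have eb : B.solve (!k) j (B.upper i za) (B.lower j zb) = zb := by rw [h1, B.solve_eq]
  have ec : B.solve (!k) (!i) (B.lower j za) (B.lower j zb) = zc := by rw [h2, h3, B.solve_eq]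
  simp only [eb, ec] at t
  exact ⟨_, _, _, by simpa only [Fits, Bool.not_not] using t,
    ⟨B.upper_solve .., B.upper_solve ..⟩, ⟨B.upper_solve .., B.lower_solve ..⟩,
    ⟨B.lower_solve .., B.lower_solve ..⟩⟩

/-- Each new crossing has one upper and one lower arc among the six ends, and these two determine
its state. -/
theorem SameEnds.unique {i j k : Bool} {za zb zc za' zb' zc' za'' zb'' zc'' : X × X}
    (h : B.SameEnds i j k za zb zc za' zb' zc') (h' : B.SameEnds i j k za zb zc za'' zb'' zc'') :
    za' = za'' ∧ zb' = zb'' ∧ zc' = zc'' :=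
  ⟨B.ext_of_arc (h.1.2.trans h'.1.2.symm) (h.2.1.2.trans h'.2.1.2.symm),
   B.ext_of_arc (h.1.1.trans h'.1.1.symm) (h.2.2.2.trans h'.2.2.2.symm),
   B.ext_of_arc (h.2.1.1.trans h'.2.1.1.symm) (h.2.2.1.trans h'.2.2.1.symm)⟩

/-- The color of the arc that ends in the passage `x`, if the crossings have the states `f`. -/
def colorIn (f : ℕ → X × X) (x : Passage) : X := B.arc x.upper (!x.pos) (f x.label)

/-- The color of the arc that leaves the passage `x`. -/
def colorOut (f : ℕ → X × X) (x : Passage) : X := B.arc x.upper x.pos (f x.label)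

/-- The states `f` of the crossings color the path `w` consistently, beginning with the color `p` and
ending with the color `q`. -/
def Path (f : ℕ → X × X) : X → List Passage → X → Prop
  | p, [], q => p = q
  | p, x :: w, q => B.colorIn f x = p ∧ Path f (B.colorOut f x) w q

variable {B} {f g : ℕ → X × X} {p q : X}

@[simp] theorem path_nil : B.Path f p [] q ↔ p = q := Iff.rfl

@[simp] theorem path_cons {x : Passage} {w : List Passage} :
    B.Path f p (x :: w) q ↔ B.colorIn f x = p ∧ B.Path f (B.colorOut f x) w q := Iff.rfl

theorem path_append {u v : List Passage} :
    B.Path f p (u ++ v) q ↔ ∃ m, B.Path f p u m ∧ B.Path f m v q := by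
  induction u generalizing p with
  | nil => simp
  | cons x u ih => simp [ih, and_assoc]

theorem Path.right_unique {w : List Passage} {q' : X} (h : B.Path f p w q) (h' : B.Path f p w q') :
    q = q' := by
  induction w generalizing p with
  | nil => exact h.symm.trans h'
  | cons x w ih => exact ih h.2 h'.2

theorem Path.left_unique {w : List Passage} {p' : X} (h : B.Path f p w q) (h' : B.Path f p' w q) :
    p = p' := by
  cases w with
  | nil => exact h.trans h'.symm
  | cons x w => exact h.1.symm.trans h'.1

theorem path_congr {w : List Passage} (h : ∀ x ∈ w, f x.label = g x.label) :
    B.Path f p w q ↔ B.Path g p w q := by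
  induction w generalizing p with
  | nil => rfl
  | cons x w ih =>
    have hx := h x (by simp)
    have ih' := fun p => ih (p := p) fun y hy => h y (by simp [hy])
    simp [colorIn, colorOut, hx, ih']

/-- A strand enters a crossing on side `!pos` and leaves on side `pos`. Hence the inner arc is on
side `s == t` of the first crossing and on side `s' != t` of the second, whichever comes first, and
the ends are on the remaining sides. -/
theorem path_pair {a b : ℕ} {o o' s s' t : Bool} :
    B.Path f p (pair t ⟨a, o, s⟩ ⟨b, o', s'⟩) q ↔
      B.arc o (s == t) (f a) = B.arc o' (s' != t) (f b) ∧
      p = (if t then B.arc o (s != t) (f a) else B.arc o' (s' == t) (f b)) ∧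
      q = (if t then B.arc o' (s' == t) (f b) else B.arc o (s != t) (f a)) := by
  cases t <;> simp [pair, colorIn, colorOut] <;> grind

/-- The effect of the third move on one strand: `hg` makes the new inner arc fit, and `h1`, `h2`
keep the colors at the two ends. -/
theorem path_pair_not {a b : ℕ} {o o' s s' t : Bool}
    (h : B.Path f p (pair t ⟨a, o, s⟩ ⟨b, o', s'⟩) q)
    (hg : B.arc o (s != t) (g a) = B.arc o' (s' == t) (g b))
    (h1 : B.arc o' (s' != t) (g b) = B.arc o (s != t) (f a))
    (h2 : B.arc o (s == t) (g a) = B.arc o' (s' == t) (f b)) :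
    B.Path g p (pair (!t) ⟨a, o, s⟩ ⟨b, o', s'⟩) q := by
  rw [path_pair] at h ⊢
  cases t <;> cases s <;> cases s' <;> simp_all

variable (B) [Inhabited X]

/-- The colorings of the closed path `w`, together with the color at the base point. The states of
the labels that are not used are fixed. -/
def Coloring (w : List Passage) : Type :=
  {c : (ℕ → X × X) × X // (∀ l, Fresh l w → c.1 l = default) ∧ B.Path c.1 c.2 w c.2}

end Biquandle

/-- For each move, colorings before and after are related when they agree away from the move.
Extension gives totality and the solvability of the crossings gives uniqueness, so that no inverse
maps have to be computed. -/
theorem nonempty_equiv_of_rel {α β : Type} (R : α → β → Prop) (h : ∀ a, ∃ b, R a b)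
    (h' : ∀ b, ∃ a, R a b) (hu : ∀ a b b', R a b → R a b' → b = b')
    (hu' : ∀ a a' b, R a b → R a' b → a = a') : Nonempty (α ≃ β) := by
  choose F hF using h
  choose G hG using h'
  exact ⟨⟨F, G, fun a => hu' _ _ _ (hG _) (hF _), fun b => hu _ _ _ (hF _) (hG _)⟩⟩

end VirtualKnot

/-! ### Validity and unused labels in the codes of the moves -/

namespace VirtualKnot

theorem IsGaussCode.perm {w w' : List Passage} (h : IsGaussCode w) (hp : w.Perm w') :
    IsGaussCode w' := by
  refine ⟨hp.nodup_iff.1 h.1, fun x hx => ?_⟩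
  obtain ⟨h1, h2⟩ := h.2 x (hp.mem_iff.2 hx)
  exact ⟨hp.mem_iff.1 h1, fun y hy => h2 y (hp.mem_iff.2 hy)⟩

theorem mem_pair {t : Bool} {x y z : Passage} : z ∈ pair t x y ↔ z = x ∨ z = y := by
  cases t <;> simp [pair, or_comm]

theorem count_pair {t : Bool} {x y z : Passage} :
    (pair t x y).count z = [x].count z + [y].count z := by
  cases t <;> simp [pair, List.count_cons, add_comm]

theorem length_pair {t : Bool} {x y : Passage} : (pair t x y).length = 2 := by
  cases t <;> rfl

/-- The passages through the three crossings of a third Reidemeister move. -/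
def trianglePassages (a b c : ℕ) (sa sb sc : Bool) : List Passage :=
  [⟨a, true, sa⟩, ⟨b, true, sb⟩, ⟨a, false, sa⟩, ⟨c, true, sc⟩, ⟨b, false, sb⟩, ⟨c, false, sc⟩]

theorem perm_triangle (a b c : ℕ) (sa sb sc t m l : Bool) (u v w : List Passage) :
    (pair t ⟨a, true, sa⟩ ⟨b, true, sb⟩ ++ u ++ pair m ⟨a, false, sa⟩ ⟨c, true, sc⟩ ++ v ++
      pair l ⟨b, false, sb⟩ ⟨c, false, sc⟩ ++ w).Perm
      (trianglePassages a b c sa sb sc ++ (u ++ v ++ w)) := by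
  rw [List.perm_iff_count]
  intro z
  simp only [List.count_append, count_pair, trianglePassages, List.count_cons, List.count_nil]
  omega

theorem perm_triangle' (a b c : ℕ) (sa sb sc t m l : Bool) (u v w : List Passage) :
    (pair t ⟨a, true, sa⟩ ⟨b, true, sb⟩ ++ u ++ pair l ⟨b, false, sb⟩ ⟨c, false, sc⟩ ++ v ++
      pair m ⟨a, false, sa⟩ ⟨c, true, sc⟩ ++ w).Perm
      (trianglePassages a b c sa sb sc ++ (u ++ v ++ w)) := by
  rw [List.perm_iff_count]
  intro z
  simp only [List.count_append, count_pair, trianglePassages, List.count_cons, List.count_nil]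
  omega

/-- The third move itself does not demand that its crossings are distinct or absent from the rest of
the code; both follow from validity of the code. -/
theorem IsGaussCode.triangle {a b c : ℕ} {sa sb sc : Bool} {r : List Passage}
    (h : IsGaussCode (trianglePassages a b c sa sb sc ++ r)) :
    a ≠ b ∧ a ≠ c ∧ b ≠ c ∧ Fresh a r ∧ Fresh b r ∧ Fresh c r := by
  obtain ⟨h1, h2⟩ := h
  simp only [trianglePassages, List.cons_append, List.nil_append, List.nodup_cons, List.mem_cons,
    not_or] at h1
  have ha := (h2 ⟨a, true, sa⟩ (by simp [trianglePassages])).2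
  have hb := (h2 ⟨b, true, sb⟩ (by simp [trianglePassages])).2
  have hc := (h2 ⟨c, true, sc⟩ (by simp [trianglePassages])).2
  have key : ∀ {d : ℕ} {s : Bool}, (∀ y ∈ trianglePassages a b c sa sb sc ++ r, y.label = d →
      y = ⟨d, true, s⟩ ∨ y = ⟨d, false, s⟩) → ⟨d, true, s⟩ ∉ r → ⟨d, false, s⟩ ∉ r → Fresh d r := by
    intro d s hd h1 h2 x hx hl
    rcases hd x (List.mem_append_right _ hx) hl with rfl | rfl
    exacts [h1 hx, h2 hx]
  simp only [Passage.mate, Bool.not_true] at ha hb hc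
  have e1 := ha ⟨b, true, sb⟩ (by simp [trianglePassages])
  have e2 := ha ⟨c, true, sc⟩ (by simp [trianglePassages])
  have e3 := hb ⟨c, true, sc⟩ (by simp [trianglePassages])
  refine ⟨?_, ?_, ?_, key ha ?_ ?_, key hb ?_ ?_, key hc ?_ ?_⟩ <;> grind

/-- Label `l` differs from the labels of all passages of the list iff it does so for both parts. -/
theorem fresh_append {l : ℕ} {u v : List Passage} : Fresh l (u ++ v) ↔ Fresh l u ∧ Fresh l v := by
  simp only [Fresh, List.mem_append]
  exact ⟨fun h => ⟨fun x hx => h x (.inl hx), fun x hx => h x (.inr hx)⟩,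
    fun h x hx => hx.elim (h.1 x) (h.2 x)⟩

theorem fresh_cons {l : ℕ} {x : Passage} {v : List Passage} :
    Fresh l (x :: v) ↔ x.label ≠ l ∧ Fresh l v := by
  simp [Fresh]

theorem fresh_perm {l : ℕ} {u v : List Passage} (h : u.Perm v) : Fresh l u ↔ Fresh l v := by
  simp [Fresh, h.mem_iff]

theorem fresh_pair {l : ℕ} {t : Bool} {x y : Passage} :
    Fresh l (pair t x y) ↔ x.label ≠ l ∧ y.label ≠ l := by
  simp [Fresh, mem_pair]

theorem fresh_triangle {l a b c : ℕ} {sa sb sc : Bool} :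
    Fresh l (trianglePassages a b c sa sb sc) ↔ a ≠ l ∧ b ≠ l ∧ c ≠ l := by
  simp only [trianglePassages, fresh_cons]
  simp [Fresh]
  tauto

/-! ### Colorings under change of base point, renaming and the first two moves -/

namespace Biquandle

variable {X : Type} (B : Biquandle X)

theorem coloring_rotate [Inhabited X] (u v : List Passage) :
    Nonempty (B.Coloring (u ++ v) ≃ B.Coloring (v ++ u)) := by
  refine nonempty_equiv_of_rel
    (fun c c' => c.1.1 = c'.1.1 ∧ B.Path c.1.1 c.1.2 u c'.1.2 ∧ B.Path c.1.1 c'.1.2 v c.1.2) ?_ ?_ ?_ ?_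
  · rintro ⟨⟨f, p⟩, hf, hp⟩
    obtain ⟨q, h1, h2⟩ := path_append.1 hp
    exact ⟨⟨(f, q), fun l hl => hf l (fresh_append.2 (fresh_append.1 hl).symm),
      path_append.2 ⟨p, h2, h1⟩⟩, rfl, h1, h2⟩
  · rintro ⟨⟨f, p⟩, hf, hp⟩
    obtain ⟨q, h1, h2⟩ := path_append.1 hp
    exact ⟨⟨(f, q), fun l hl => hf l (fresh_append.2 (fresh_append.1 hl).symm),
      path_append.2 ⟨p, h2, h1⟩⟩, rfl, h2, h1⟩
  · rintro ⟨⟨f, p⟩, _⟩ ⟨⟨f', p'⟩, _⟩ ⟨⟨f'', p''⟩, _⟩ ⟨e, h, _⟩ ⟨e', h', _⟩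
    exact Subtype.ext (Prod.ext (e.symm.trans e') (h.right_unique h'))
  · rintro ⟨⟨f, p⟩, _⟩ ⟨⟨f', p'⟩, _⟩ ⟨⟨f'', p''⟩, _⟩ ⟨e, h, _⟩ ⟨e', h', _⟩
    have e'' : f = f' := e.trans e'.symm
    subst e''
    exact Subtype.ext (Prod.ext rfl (h.left_unique h'))

theorem path_rename {f g : ℕ → X × X} {p q : X} {r : ℕ → ℕ} {w : List Passage}
    (h : ∀ l, f l = g (r l)) : B.Path g p (w.map (Passage.rename r)) q ↔ B.Path f p w q := by
  induction w generalizing p with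
  | nil => rfl
  | cons x w ih => simp [colorIn, colorOut, Passage.rename, h, ih]

theorem coloring_rename [Inhabited X] (r : ℕ → ℕ) (hr : Function.Injective r) (w : List Passage) :
    Nonempty (B.Coloring w ≃ B.Coloring (w.map (Passage.rename r))) := by
  have fresh : ∀ l, Fresh l w ↔ Fresh (r l) (w.map (Passage.rename r)) := fun l => by
    simp [Fresh, Passage.rename, hr.eq_iff]
  refine nonempty_equiv_of_rel (fun c c' => (∀ l, c.1.1 l = c'.1.1 (r l)) ∧ c.1.2 = c'.1.2) ?_ ?_ ?_ ?_
  · rintro ⟨⟨f, p⟩, hf, hp⟩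
    -- Labels outside the range of `r` do not occur in the renamed code, so their state has to be
    -- the default one.
    have e : ∀ l, f l = Function.extend r f (fun _ => default) (r l) :=
      fun l => (hr.extend_apply ..).symm
    refine ⟨⟨(Function.extend r f fun _ => default, p), fun l hl => ?_, (B.path_rename e).2 hp⟩, e, rfl⟩
    by_cases h : ∃ k, r k = l
    · obtain ⟨k, rfl⟩ := h
      exact (e k).symm.trans (hf k ((fresh k).2 hl))
    · exact Function.extend_apply' f (fun _ => default) l h
  · rintro ⟨⟨f, p⟩, hf, hp⟩
    exact ⟨⟨(fun l => f (r l), p), fun l hl => hf _ ((fresh l).1 hl),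
      (B.path_rename (r := r) fun _ => rfl).1 hp⟩, fun _ => rfl, rfl⟩
  · rintro ⟨⟨f, p⟩, _⟩ ⟨⟨f', p'⟩, h', _⟩ ⟨⟨f'', p''⟩, h'', _⟩ ⟨e', h1⟩ ⟨e'', h2⟩
    refine Subtype.ext (Prod.ext (funext fun l => ?_) (h1.symm.trans h2))
    by_cases h : ∃ k, r k = l
    · obtain ⟨k, rfl⟩ := h
      exact (e' k).symm.trans (e'' k)
    · have hl : Fresh l (w.map (Passage.rename r)) := by
        simp only [Fresh, List.mem_map]
        rintro _ ⟨x, _, rfl⟩ hx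
        exact h ⟨_, hx⟩
      exact (h' l hl).trans (h'' l hl).symm
  · rintro ⟨⟨f, p⟩, _⟩ ⟨⟨f', p'⟩, _⟩ ⟨⟨f'', p''⟩, _⟩ ⟨e', h1⟩ ⟨e'', h2⟩
    exact Subtype.ext (Prod.ext (funext fun l => (e' l).trans (e'' l).symm) (h1.trans h2.symm))

theorem path_update {f : ℕ → X × X} {p q : X} {a : ℕ} {z : X × X} {w : List Passage}
    (ha : Fresh a w) : B.Path (Function.update f a z) p w q ↔ B.Path f p w q :=
  path_congr fun x hx => Function.update_of_ne (ha x hx) _ _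

/-- The loop closes by one of the two equations in the field `kink`, depending on `o` and `s`; the
other one says that the color after the kink is the color before it. -/
theorem path_kink {f : ℕ → X × X} {p q : X} {a : ℕ} {o s : Bool} {w : List Passage} :
    B.Path f p (⟨a, o, s⟩ :: ⟨a, !o, s⟩ :: w) q ↔
      B.upper true (f a) = B.lower false (f a) ∧ B.arc o (!s) (f a) = p ∧ B.Path f p w q := by
  have k := B.kink (f a)
  cases o <;> cases s <;> simp [colorIn, colorOut] <;> grind

theorem arc_kink {o i : Bool} {z : X × X} (h : B.upper true z = B.lower false z) :
    B.arc o i z = B.upper (if o then i else !i) z := by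
  have k := (B.kink z).1 h
  cases o <;> cases i <;> simp [h, k]

theorem coloring_reidemeister1 [Inhabited X] (a : ℕ) (o s : Bool) (w : List Passage) (ha : Fresh a w) :
    Nonempty (B.Coloring w ≃ B.Coloring (⟨a, o, s⟩ :: ⟨a, !o, s⟩ :: w)) := by
  refine nonempty_equiv_of_rel
    (fun c c' => (∀ l, l ≠ a → c.1.1 l = c'.1.1 l) ∧ c.1.2 = c'.1.2) ?_ ?_ ?_ ?_
  · rintro ⟨⟨f, p⟩, hf, hp⟩
    refine ⟨⟨(Function.update f a (B.kinkSolve (if o then !s else s) p), p), fun l hl => ?_, ?_⟩,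
      fun l hl => (Function.update_of_ne hl _ _).symm, rfl⟩
    · simp only [fresh_cons] at hl
      exact (Function.update_of_ne hl.1.symm _ _).trans (hf l hl.2.2)
    · dsimp only
      rw [path_kink, B.path_update ha, Function.update_self]
      refine ⟨B.kinkSolve_kink _ _, ?_, hp⟩
      rw [B.arc_kink (B.kinkSolve_kink _ _)]
      cases o <;> simp [B.upper_kinkSolve]
  · rintro ⟨⟨f, p⟩, hf, hp⟩
    refine ⟨⟨(Function.update f a default, p), fun l hl => ?_, ?_⟩,
      fun l hl => Function.update_of_ne hl _ _, rfl⟩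
    · rcases eq_or_ne l a with rfl | h
      · exact Function.update_self ..
      · exact (Function.update_of_ne h _ _).trans (hf l (by simp [fresh_cons, hl, h.symm]))
    · rw [B.path_update ha]
      exact (B.path_kink.1 hp).2.2
  · rintro ⟨⟨f, p⟩, _⟩ ⟨⟨f', p'⟩, _, h'⟩ ⟨⟨f'', p''⟩, _, h''⟩ ⟨e', h1⟩ ⟨e'', h2⟩
    dsimp only at h1 h2 e' e'' h' h''
    subst h1 h2
    refine Subtype.ext (Prod.ext (funext fun l => ?_) rfl)
    rcases eq_or_ne l a with rfl | h
    · obtain ⟨k', c', _⟩ := B.path_kink.1 h'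
      obtain ⟨k'', c'', _⟩ := B.path_kink.1 h''
      rw [B.arc_kink k'] at c'
      rw [B.arc_kink k''] at c''
      exact (B.kinkSolve_eq _ _ k').symm.trans ((congrArg _ (c'.trans c''.symm)).trans
        (B.kinkSolve_eq _ _ k''))
    · exact (e' l h).symm.trans (e'' l h)
  · rintro ⟨⟨f, p⟩, hf, _⟩ ⟨⟨f', p'⟩, hf', _⟩ ⟨⟨f'', p''⟩, _⟩ ⟨e', h1⟩ ⟨e'', h2⟩
    refine Subtype.ext (Prod.ext (funext fun l => ?_) (h1.trans h2.symm))
    rcases eq_or_ne l a with rfl | h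
    · exact (hf l ha).trans (hf' l ha).symm
    · exact (e' l h).trans (e'' l h).symm

theorem path_over_pair {f : ℕ → X × X} {p q : X} {a b : ℕ} {s : Bool} :
    B.Path f p (pair true ⟨a, true, s⟩ ⟨b, true, !s⟩) q ↔
      B.upper s (f a) = B.upper s (f b) ∧ p = B.upper (!s) (f a) ∧ q = B.upper (!s) (f b) := by
  rw [path_pair]
  cases s <;> simp

theorem path_under_pair {f : ℕ → X × X} {p q : X} {a b : ℕ} {s t : Bool} :
    B.Path f p (pair t ⟨a, false, s⟩ ⟨b, false, !s⟩) q ↔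
      B.lower (s == t) (f a) = B.lower (s == t) (f b) ∧
      p = (if t then B.lower (s != t) (f a) else B.lower (s != t) (f b)) ∧
      q = (if t then B.lower (s != t) (f b) else B.lower (s != t) (f a)) := by
  rw [path_pair]
  cases s <;> cases t <;> simp

/-- As the signs are opposite, the two crossings share an upper arc and a lower arc on matching
sides. So they have the same state, and the colors pass through the bigon unchanged. -/
theorem path_bigon {f : ℕ → X × X} {p q p' q' : X} {a b : ℕ} {s t : Bool} :
    (B.Path f p (pair true ⟨a, true, s⟩ ⟨b, true, !s⟩) q ∧
      B.Path f p' (pair t ⟨a, false, s⟩ ⟨b, false, !s⟩) q') ↔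
    f a = B.solve (!s) (s != t) p p' ∧ f b = B.solve (!s) (s != t) p p' ∧ p = q ∧ p' = q' := by
  rw [path_over_pair, path_under_pair]
  constructor
  · rintro ⟨⟨h1, h2, h3⟩, h4, h5, h6⟩
    have e : f a = f b := B.ext_of_arc h1 h4
    rw [← e] at h3 h5 h6
    simp only [ite_self] at h5 h6
    rw [← e, h2, h5, B.solve_eq]
    exact ⟨rfl, rfl, h3.symm, h6.symm⟩
  · rintro ⟨h1, h2, rfl, rfl⟩
    simp [h1, h2, B.upper_solve, B.lower_solve]

theorem path_reidemeister2 {f : ℕ → X × X} {p q : X} {a b : ℕ} {s t : Bool} {u v : List Passage} :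
    B.Path f p (pair true ⟨a, true, s⟩ ⟨b, true, !s⟩ ++ u ++ pair t ⟨a, false, s⟩ ⟨b, false, !s⟩ ++ v)
      q ↔ ∃ m, B.Path f p u m ∧ B.Path f m v q ∧ f a = B.solve (!s) (s != t) p m ∧
        f b = B.solve (!s) (s != t) p m := by
  simp only [path_append]
  constructor
  · rintro ⟨m, ⟨m', ⟨m'', h1, h2⟩, h3⟩, h4⟩
    obtain ⟨ha, hb, rfl, rfl⟩ := B.path_bigon.1 ⟨h1, h3⟩
    exact ⟨_, h2, h4, ha, hb⟩
  · rintro ⟨m, h1, h2, ha, hb⟩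
    obtain ⟨h3, h4⟩ := B.path_bigon.2 ⟨ha, hb, rfl, rfl⟩
    exact ⟨m, ⟨m, ⟨p, h3, h1⟩, h4⟩, h2⟩

theorem coloring_reidemeister2 [Inhabited X] (a b : ℕ) (s t : Bool) (u v : List Passage) (hab : a ≠ b)
    (ha : Fresh a (u ++ v)) (hb : Fresh b (u ++ v)) :
    Nonempty (B.Coloring (u ++ v) ≃ B.Coloring
      (pair true ⟨a, true, s⟩ ⟨b, true, !s⟩ ++ u ++ pair t ⟨a, false, s⟩ ⟨b, false, !s⟩ ++ v)) := by
  obtain ⟨hau, hav⟩ := fresh_append.1 ha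
  obtain ⟨hbu, hbv⟩ := fresh_append.1 hb
  refine nonempty_equiv_of_rel
    (fun c c' => (∀ l, l ≠ a → l ≠ b → c.1.1 l = c'.1.1 l) ∧ c.1.2 = c'.1.2) ?_ ?_ ?_ ?_
  · rintro ⟨⟨f, p⟩, hf, hp⟩
    obtain ⟨m, h1, h2⟩ := path_append.1 hp
    refine ⟨⟨(Function.update (Function.update f a (B.solve (!s) (s != t) p m)) b
      (B.solve (!s) (s != t) p m), p), fun l hl => ?_, B.path_reidemeister2.2 ⟨m, ?_, ?_, ?_, ?_⟩⟩,
      fun l hl hl' => ?_, rfl⟩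
    · simp only [fresh_append, fresh_pair] at hl
      obtain ⟨⟨⟨⟨h1, h2⟩, h3⟩, _⟩, h4⟩ := hl
      dsimp only
      rw [Function.update_of_ne (Ne.symm h2), Function.update_of_ne (Ne.symm h1)]
      exact hf l (fresh_append.2 ⟨h3, h4⟩)
    · rwa [B.path_update hbu, B.path_update hau]
    · rwa [B.path_update hbv, B.path_update hav]
    · dsimp only
      rw [Function.update_of_ne hab, Function.update_self]
    · exact Function.update_self ..
    · dsimp only
      rw [Function.update_of_ne hl', Function.update_of_ne hl]
  · rintro ⟨⟨f, p⟩, hf, hp⟩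
    obtain ⟨m, h1, h2, _⟩ := B.path_reidemeister2.1 hp
    refine ⟨⟨(Function.update (Function.update f a default) b default, p), fun l hl => ?_,
      path_append.2 ⟨m, ?_, ?_⟩⟩, fun l hl hl' => ?_, rfl⟩
    · rcases eq_or_ne l b with rfl | h
      · exact Function.update_self ..
      dsimp only
      rw [Function.update_of_ne h]
      rcases eq_or_ne l a with rfl | h'
      · exact Function.update_self ..
      rw [Function.update_of_ne h']
      obtain ⟨hu, hv⟩ := fresh_append.1 hl
      refine hf l ?_
      simp only [fresh_append, fresh_pair]
      exact ⟨⟨⟨⟨h'.symm, h.symm⟩, hu⟩, h'.symm, h.symm⟩, hv⟩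
    · rwa [B.path_update hbu, B.path_update hau]
    · rwa [B.path_update hbv, B.path_update hav]
    · dsimp only
      rw [Function.update_of_ne hl', Function.update_of_ne hl]
  · rintro ⟨⟨f, p⟩, _⟩ ⟨⟨f', p'⟩, _, h'⟩ ⟨⟨f'', p''⟩, _, h''⟩ ⟨e', h1⟩ ⟨e'', h2⟩
    dsimp only at h1 h2 e' e'' h' h''
    subst h1 h2
    obtain ⟨m', hu', hv', ha', hb'⟩ := B.path_reidemeister2.1 h'
    obtain ⟨m'', hu'', hv'', ha'', hb''⟩ := B.path_reidemeister2.1 h''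
    have e : ∀ l, l ≠ a → l ≠ b → f' l = f'' l := fun l h h' => (e' l h h').symm.trans (e'' l h h')
    -- The states of `a` and `b` are solved from `p` and the color `m` where the lower strand
    -- enters. That color is the end of the path `u`, which avoids both crossings.
    have em : m' = m'' := hu'.right_unique
      ((path_congr fun x hx => e _ (hau x hx) (hbu x hx)).2 hu'')
    subst em
    refine Subtype.ext (Prod.ext (funext fun l => ?_) rfl)
    rcases eq_or_ne l a with rfl | h
    · exact ha'.trans ha''.symm
    rcases eq_or_ne l b with rfl | h'
    · exact hb'.trans hb''.symm
    · exact e l h h'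
  · rintro ⟨⟨f, p⟩, hf, _⟩ ⟨⟨f', p'⟩, hf', _⟩ ⟨⟨f'', p''⟩, _⟩ ⟨e', h1⟩ ⟨e'', h2⟩
    refine Subtype.ext (Prod.ext (funext fun l => ?_) (h1.trans h2.symm))
    rcases eq_or_ne l a with rfl | h
    · exact (hf l ha).trans (hf' l ha).symm
    rcases eq_or_ne l b with rfl | h'
    · exact (hf l hb).trans (hf' l hb).symm
    · exact (e' l h h').trans (e'' l h h').symm

end Biquandle

end VirtualKnot

/-! ### Colorings under the third Reidemeister move -/

namespace VirtualKnot

/-- The planarity conditions on a triangle reduce the six sides on which its inner arcs lie to the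
three parameters `i`, `j`, `k` of the field `triangle`. -/
theorem triangle_signs : ∀ sa sb sc t m l : Bool, ((sa = sb) ↔ (m = l)) → ((sa = sc) ↔ (t = l)) →
    (sb == l) = (sa == m) ∧ (sc == m) = (sb == t) ∧ (sc == l) = (sa == t) := by
  decide

namespace Biquandle

variable {X : Type} (B : Biquandle X)

/-- Every coloring of `w` extends, after new states have been given to the crossings `a`, `b`, `c` of a
triangle, to a coloring of `w'`. -/
def TriangleStep (a b c : ℕ) (i j k : Bool) (w w' : List Passage) : Prop :=
  ∀ f p, B.Path f p w p → ∃ za zb zc, B.SameEnds i j k (f a) (f b) (f c) za zb zc ∧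
    ∀ g : ℕ → X × X, (∀ l, l ≠ a → l ≠ b → l ≠ c → f l = g l) → g a = za → g b = zb → g c = zc →
      B.Path g p w' p

variable {B}

theorem TriangleStep.exists_coloring [Inhabited X] {a b c : ℕ} {i j k : Bool} {w w' : List Passage}
    (h : B.TriangleStep a b c i j k w w') (hab : a ≠ b) (hac : a ≠ c) (hbc : b ≠ c)
    (hw : ∀ l, l ≠ a → l ≠ b → l ≠ c → Fresh l w' → Fresh l w)
    (hw' : ∀ l, Fresh l w' → l ≠ a ∧ l ≠ b ∧ l ≠ c) (x : B.Coloring w) :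
    ∃ y : B.Coloring w', (∀ l, l ≠ a → l ≠ b → l ≠ c → x.1.1 l = y.1.1 l) ∧
      B.SameEnds i j k (x.1.1 a) (x.1.1 b) (x.1.1 c) (y.1.1 a) (y.1.1 b) (y.1.1 c) ∧
      x.1.2 = y.1.2 := by
  obtain ⟨⟨f, p⟩, hf, hp⟩ := x
  obtain ⟨za, zb, zc, hs, hg⟩ := h f p hp
  let g := Function.update (Function.update (Function.update f a za) b zb) c zc
  have e : ∀ l, l ≠ a → l ≠ b → l ≠ c → f l = g l := fun l h1 h2 h3 => by
    simp [g, Function.update_of_ne, h1, h2, h3]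
  have ha : g a = za := by simp [g, Function.update_of_ne, hab, hac]
  have hb : g b = zb := by simp [g, Function.update_of_ne, hbc]
  have hc : g c = zc := by simp [g]
  refine ⟨⟨(g, p), fun l hl => ?_, hg g e ha hb hc⟩, e, by simpa only [ha, hb, hc] using hs, rfl⟩
  obtain ⟨h1, h2, h3⟩ := hw' l hl
  exact (e l h1 h2 h3).symm.trans (hf l (hw l h1 h2 h3 hl))

/-- `SameEnds` is symmetric up to negating the three sides, so the step for the reversed move
supplies preimages, and `SameEnds.unique` gives uniqueness in both directions. -/
theorem TriangleStep.nonempty_equiv [Inhabited X] {a b c : ℕ} {i j k : Bool} {w w' : List Passage}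
    {sa sb sc : Bool} {r : List Passage}
    (h : B.TriangleStep a b c i j k w w') (h' : B.TriangleStep a b c (!i) (!j) (!k) w' w)
    (hp : w.Perm (trianglePassages a b c sa sb sc ++ r))
    (hp' : w'.Perm (trianglePassages a b c sa sb sc ++ r)) (hv : IsGaussCode w) :
    Nonempty (B.Coloring w ≃ B.Coloring w') := by
  obtain ⟨hab, hac, hbc, -⟩ := (hv.perm hp).triangle
  have fr : ∀ l, Fresh l w ↔ Fresh l w' := fun l => (fresh_perm hp).trans (fresh_perm hp').symm
  have fr' : ∀ l, Fresh l w' → l ≠ a ∧ l ≠ b ∧ l ≠ c := fun l hl => by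
    have h := fresh_triangle.1 (fresh_append.1 ((fresh_perm hp').1 hl)).1
    exact ⟨h.1.symm, h.2.1.symm, h.2.2.symm⟩
  refine nonempty_equiv_of_rel
    (fun x y => (∀ l, l ≠ a → l ≠ b → l ≠ c → x.1.1 l = y.1.1 l) ∧
      B.SameEnds i j k (x.1.1 a) (x.1.1 b) (x.1.1 c) (y.1.1 a) (y.1.1 b) (y.1.1 c) ∧
      x.1.2 = y.1.2)
    (h.exists_coloring hab hac hbc (fun l _ _ _ hl => (fr l).2 hl) fr') (fun y => ?_) ?_ ?_
  · obtain ⟨x, h1, h2, h3⟩ := h'.exists_coloring hab hac hbc (fun l _ _ _ hl => (fr l).1 hl)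
      (fun l hl => fr' l ((fr l).1 hl)) y
    have h4 := h2.symm
    simp only [Bool.not_not] at h4
    exact ⟨x, fun l ha hb hc => (h1 l ha hb hc).symm, h4, h3.symm⟩
  · rintro x y y' ⟨h1, h2, h3⟩ ⟨h1', h2', h3'⟩
    obtain ⟨ea, eb, ec⟩ := h2.unique B h2'
    refine Subtype.ext (Prod.ext (funext fun l => ?_) (h3.symm.trans h3'))
    by_cases ha : l = a
    · exact ha ▸ ea
    by_cases hb : l = b
    · exact hb ▸ eb
    by_cases hc : l = c
    · exact hc ▸ ec
    exact (h1 l ha hb hc).symm.trans (h1' l ha hb hc)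
  · rintro x y y' ⟨h1, h2, h3⟩ ⟨h1', h2', h3'⟩
    obtain ⟨ea, eb, ec⟩ := h2.symm.unique B h2'.symm
    refine Subtype.ext (Prod.ext (funext fun l => ?_) (h3.trans h3'.symm))
    by_cases ha : l = a
    · exact ha ▸ ea
    by_cases hb : l = b
    · exact hb ▸ eb
    by_cases hc : l = c
    · exact hc ▸ ec
    exact (h1 l ha hb hc).trans (h1' l ha hb hc).symm

/-- The local content of the third move. It does not depend on the order in which the knot runs
through the three strands, and so serves both constructors. -/
theorem exists_triangle {f : ℕ → X × X} {a b c : ℕ} {sa sb sc t m l : Bool}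
    (hab : (sa = sb) ↔ (m = l)) (hac : (sa = sc) ↔ (t = l)) {p q p' q' p'' q'' : X}
    (h1 : B.Path f p (pair t ⟨a, true, sa⟩ ⟨b, true, sb⟩) q)
    (h2 : B.Path f p' (pair m ⟨a, false, sa⟩ ⟨c, true, sc⟩) q')
    (h3 : B.Path f p'' (pair l ⟨b, false, sb⟩ ⟨c, false, sc⟩) q'') :
    ∃ za zb zc, B.SameEnds (sa == t) (sa == m) (sb == t) (f a) (f b) (f c) za zb zc ∧
      ∀ g : ℕ → X × X, g a = za → g b = zb → g c = zc →
        B.Path g p (pair (!t) ⟨a, true, sa⟩ ⟨b, true, sb⟩) q ∧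
        B.Path g p' (pair (!m) ⟨a, false, sa⟩ ⟨c, true, sc⟩) q' ∧
        B.Path g p'' (pair (!l) ⟨b, false, sb⟩ ⟨c, false, sc⟩) q'' := by
  obtain ⟨e1, e2, e3⟩ := triangle_signs sa sb sc t m l hab hac
  have n : ∀ x y : Bool, (x != y) = !(x == y) := fun _ _ => rfl
  have i1 := (path_pair.1 h1).1
  have i2 := (path_pair.1 h2).1
  have i3 := (path_pair.1 h3).1
  simp only [n, e1, e2, e3, arc_true, arc_false] at i1 i2 i3
  obtain ⟨za, zb, zc, ⟨f1, f2, f3⟩, hs⟩ := B.exists_sameEnds ⟨i1, i2, i3⟩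
  simp only [Bool.not_not] at f1 f2 f3
  refine ⟨za, zb, zc, hs, ?_⟩
  rintro g rfl rfl rfl
  obtain ⟨⟨s1, s2⟩, ⟨s3, s4⟩, s5, s6⟩ := hs
  refine ⟨path_pair_not h1 ?_ ?_ ?_, path_pair_not h2 ?_ ?_ ?_, path_pair_not h3 ?_ ?_ ?_⟩ <;>
    simpa only [n, e1, e2, e3, arc_true, arc_false]

theorem triangleStep_reidemeister3 {a b c : ℕ} {sa sb sc t m l : Bool} {u v w : List Passage}
    (hab : (sa = sb) ↔ (m = l)) (hac : (sa = sc) ↔ (t = l))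
    (ha : Fresh a (u ++ v ++ w)) (hb : Fresh b (u ++ v ++ w)) (hc : Fresh c (u ++ v ++ w)) :
    B.TriangleStep a b c (sa == t) (sa == m) (sb == t)
      (pair t ⟨a, true, sa⟩ ⟨b, true, sb⟩ ++ u ++ pair m ⟨a, false, sa⟩ ⟨c, true, sc⟩ ++ v ++
        pair l ⟨b, false, sb⟩ ⟨c, false, sc⟩ ++ w)
      (pair (!t) ⟨a, true, sa⟩ ⟨b, true, sb⟩ ++ u ++ pair (!m) ⟨a, false, sa⟩ ⟨c, true, sc⟩ ++ v ++
        pair (!l) ⟨b, false, sb⟩ ⟨c, false, sc⟩ ++ w) := by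
  intro f p h
  obtain ⟨m5, h, hw⟩ := path_append.1 h
  obtain ⟨m4, h, h3⟩ := path_append.1 h
  obtain ⟨m3, h, hv⟩ := path_append.1 h
  obtain ⟨m2, h, h2⟩ := path_append.1 h
  obtain ⟨m1, h1, hu⟩ := path_append.1 h
  obtain ⟨za, zb, zc, hs, hg⟩ := exists_triangle hab hac h1 h2 h3
  refine ⟨za, zb, zc, hs, fun g e ea eb ec => ?_⟩
  obtain ⟨g1, g2, g3⟩ := hg g ea eb ec
  have e' : ∀ x ∈ u ++ v ++ w, f x.label = g x.label := fun x hx =>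
    e _ (ha x hx) (hb x hx) (hc x hx)
  refine path_append.2 ⟨m5, path_append.2 ⟨m4, path_append.2 ⟨m3, path_append.2 ⟨m2,
    path_append.2 ⟨m1, g1, (path_congr fun x hx => e' x ?_).1 hu⟩, g2⟩,
    (path_congr fun x hx => e' x ?_).1 hv⟩, g3⟩, (path_congr fun x hx => e' x ?_).1 hw⟩ <;> simp [hx]

theorem triangleStep_reidemeister3' {a b c : ℕ} {sa sb sc t m l : Bool} {u v w : List Passage}
    (hab : (sa = sb) ↔ (m = l)) (hac : (sa = sc) ↔ (t = l))
    (ha : Fresh a (u ++ v ++ w)) (hb : Fresh b (u ++ v ++ w)) (hc : Fresh c (u ++ v ++ w)) :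
    B.TriangleStep a b c (sa == t) (sa == m) (sb == t)
      (pair t ⟨a, true, sa⟩ ⟨b, true, sb⟩ ++ u ++ pair l ⟨b, false, sb⟩ ⟨c, false, sc⟩ ++ v ++
        pair m ⟨a, false, sa⟩ ⟨c, true, sc⟩ ++ w)
      (pair (!t) ⟨a, true, sa⟩ ⟨b, true, sb⟩ ++ u ++ pair (!l) ⟨b, false, sb⟩ ⟨c, false, sc⟩ ++ v ++
        pair (!m) ⟨a, false, sa⟩ ⟨c, true, sc⟩ ++ w) := by
  intro f p h
  obtain ⟨m5, h, hw⟩ := path_append.1 h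
  obtain ⟨m4, h, h2⟩ := path_append.1 h
  obtain ⟨m3, h, hv⟩ := path_append.1 h
  obtain ⟨m2, h, h3⟩ := path_append.1 h
  obtain ⟨m1, h1, hu⟩ := path_append.1 h
  obtain ⟨za, zb, zc, hs, hg⟩ := exists_triangle hab hac h1 h2 h3
  refine ⟨za, zb, zc, hs, fun g e ea eb ec => ?_⟩
  obtain ⟨g1, g2, g3⟩ := hg g ea eb ec
  have e' : ∀ x ∈ u ++ v ++ w, f x.label = g x.label := fun x hx =>
    e _ (ha x hx) (hb x hx) (hc x hx)
  refine path_append.2 ⟨m5, path_append.2 ⟨m4, path_append.2 ⟨m3, path_append.2 ⟨m2,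
    path_append.2 ⟨m1, g1, (path_congr fun x hx => e' x ?_).1 hu⟩, g3⟩,
    (path_congr fun x hx => e' x ?_).1 hv⟩, g2⟩, (path_congr fun x hx => e' x ?_).1 hw⟩ <;> simp [hx]

variable (B)

theorem coloring_move [Inhabited X] {w w' : List Passage} (h : Move w w') (hw : IsGaussCode w) :
    Nonempty (B.Coloring w ≃ B.Coloring w') := by
  have n : ∀ x y : Bool, (x == !y) = !(x == y) := by decide
  cases h with
  | rotate u v => exact B.coloring_rotate u v
  | rename f hf w => exact B.coloring_rename f hf w
  | reidemeister1 a o s w ha => exact B.coloring_reidemeister1 a o s w ha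
  | reidemeister2 a b s t u v hab ha hb => exact B.coloring_reidemeister2 a b s t u v hab ha hb
  | reidemeister3 a b c sa sb sc t m l u v w hab hac =>
    obtain ⟨-, -, -, ha, hb, hc⟩ := (hw.perm (perm_triangle ..)).triangle
    refine TriangleStep.nonempty_equiv (triangleStep_reidemeister3 hab hac ha hb hc) ?_
      (perm_triangle ..) (perm_triangle ..) hw
    -- The inverse of a third move is again one, with all three orders negated; the planarity
    -- conditions only compare these orders and are unaffected.
    have h := triangleStep_reidemeister3 (B := B) (t := !t) (m := !m) (l := !l)
      (by simpa using hab) (by simpa using hac) ha hb hc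
    simpa only [n, Bool.not_not] using h
  | reidemeister3' a b c sa sb sc t m l u v w hab hac =>
    obtain ⟨-, -, -, ha, hb, hc⟩ := (hw.perm (perm_triangle' ..)).triangle
    refine TriangleStep.nonempty_equiv (triangleStep_reidemeister3' hab hac ha hb hc) ?_
      (perm_triangle' ..) (perm_triangle' ..) hw
    have h := triangleStep_reidemeister3' (B := B) (t := !t) (m := !m) (l := !l)
      (by simpa using hab) (by simpa using hac) ha hb hc
    simpa only [n, Bool.not_not] using h

end Biquandle

end VirtualKnot

/-! ### Finite biquandles given by tables -/

namespace VirtualKnot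

namespace Biquandle

/-- The entry of a table, given by its list of rows. -/
def entry {n : ℕ} (T : List (List (Fin n))) (x y : Fin n) : Fin n := (T.getD x []).getD y x

/-- The colors of the upper arcs, for the state `(x, y)` in which the upper arc on side `true` has the
color `x` and the lower arc on side `false` has the color `y`. -/
def tableUpper {n : ℕ} (U : List (List (Fin n))) (i : Bool) (z : Fin n × Fin n) : Fin n :=
  if i then z.1 else entry U z.1 z.2

/-- The colors of the lower arcs. -/
def tableLower {n : ℕ} (L : List (List (Fin n))) (i : Bool) (z : Fin n × Fin n) : Fin n :=
  if i then entry L z.2 z.1 else z.2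

/-- The state in which two arcs have given colors. -/
def tableSolve {n : ℕ} (U' L' S₁ S₂ : List (List (Fin n))) (i j : Bool) (x y : Fin n) :
    Fin n × Fin n :=
  if i then (if j then (x, entry L' x y) else (x, y))
  else (if j then (entry S₁ x y, entry S₂ x y) else (entry U' x y, y))

/-- An entry of a table with one row. -/
def root {n : ℕ} (Q : List (Fin n)) (x : Fin n) : Fin n := Q.getD x x

/-- The state of a kink in which the upper arc on side `i` has a given color. -/
def tableKink {n : ℕ} (Q : List (Fin n)) (i : Bool) (x : Fin n) : Fin n × Fin n :=
  if i then (x, x) else (root Q x, root Q x)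

/-- The finite biquandle with operation tables `U` and `L`; the other tables contain the solutions of
the equations in the definition of a biquandle. -/
def ofTables {n : ℕ} (U L U' L' S₁ S₂ : List (List (Fin n))) (Q : List (Fin n))
    (h₁ : ∀ i j x y, tableUpper U i (tableSolve U' L' S₁ S₂ i j x y) = x ∧
      tableLower L j (tableSolve U' L' S₁ S₂ i j x y) = y)
    (h₂ : ∀ i j x y, tableSolve U' L' S₁ S₂ i j (tableUpper U i (x, y)) (tableLower L j (x, y)) = (x, y))
    -- In these coordinates the kink states are the diagonal pairs, and `root Q` inverts the
    -- squaring map `x ↦ entry U x x`.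
    (h₃ : ∀ x y, x = y ↔ entry U x y = entry L y x)
    (h₄ : ∀ x, entry U (root Q x) (root Q x) = x)
    (h₅ : ∀ x, root Q (entry U x x) = x)
    (h₆ : ∀ i j k x x' y,
      let za := (x, x')
      let zb := tableSolve U' L' S₁ S₂ (!k) j (tableUpper U i za) y
      let zc := tableSolve U' L' S₁ S₂ (!k) (!i) (tableLower L j za) y
      let za' := tableSolve U' L' S₁ S₂ i j (tableUpper U k zb) (tableUpper U k zc)
      let zb' := tableSolve U' L' S₁ S₂ (!k) j (tableUpper U (!i) za) (tableLower L i zc)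
      let zc' := tableSolve U' L' S₁ S₂ (!k) (!i) (tableLower L (!j) za) (tableLower L (!j) zb)
      tableUpper U (!i) za' = tableUpper U k zb' ∧ tableLower L (!j) za' = tableUpper U k zc' ∧
        tableLower L (!j) zb' = tableLower L i zc') :
    Biquandle (Fin n) where
  upper := tableUpper U
  lower := tableLower L
  solve := tableSolve U' L' S₁ S₂
  kinkSolve := tableKink Q
  upper_solve i j x y := (h₁ i j x y).1
  lower_solve i j x y := (h₁ i j x y).2
  solve_eq i j z := h₂ i j z.1 z.2
  kink z := h₃ z.1 z.2
  upper_kinkSolve i x := by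
    cases i
    · exact h₄ x
    · rfl
  kinkSolve_kink i x := by cases i <;> rfl
  kinkSolve_eq i z h := by
    obtain ⟨x, y⟩ := z
    obtain rfl : x = y := h
    cases i
    · simp [tableKink, tableUpper, h₅]
    · rfl
  triangle i j k z y := h₆ i j k z.1 z.2 y

/-- A biquandle with four elements. -/
def biquandle4 : Biquandle (Fin 4) :=
  ofTables
    [[0, 3, 2, 1], [1, 2, 3, 0], [3, 0, 1, 2], [2, 1, 0, 3]]
    [[0, 3, 2, 1], [1, 2, 3, 0], [3, 0, 1, 2], [2, 1, 0, 3]]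
    [[0, 2, 3, 1], [1, 3, 2, 0], [3, 1, 0, 2], [2, 0, 1, 3]]
    [[0, 1, 3, 2], [2, 3, 1, 0], [3, 2, 0, 1], [1, 0, 2, 3]]
    [[0, 1, 3, 2], [3, 2, 0, 1], [2, 3, 1, 0], [1, 0, 2, 3]]
    [[0, 3, 2, 1], [1, 2, 3, 0], [3, 0, 1, 2], [2, 1, 0, 3]]
    [0, 2, 1, 3]
    (by decide +kernel) (by decide +kernel) (by decide) (by decide) (by decide) (by decide +kernel)

/-- Another biquandle with four elements. -/
def biquandle4' : Biquandle (Fin 4) :=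
  ofTables
    [[1, 1, 1, 1], [0, 0, 0, 0], [3, 3, 3, 3], [2, 2, 2, 2]]
    [[1, 3, 2, 0], [2, 0, 1, 3], [0, 2, 3, 1], [3, 1, 0, 2]]
    [[1, 1, 1, 1], [0, 0, 0, 0], [3, 3, 3, 3], [2, 2, 2, 2]]
    [[2, 0, 1, 3], [1, 3, 2, 0], [3, 1, 0, 2], [0, 2, 3, 1]]
    [[1, 1, 1, 1], [0, 0, 0, 0], [3, 3, 3, 3], [2, 2, 2, 2]]
    [[1, 3, 2, 0], [2, 0, 1, 3], [0, 2, 3, 1], [3, 1, 0, 2]]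
    [1, 0, 3, 2]
    (by decide +kernel) (by decide +kernel) (by decide) (by decide) (by decide) (by decide +kernel)

/-- A biquandle with nine elements. -/
def biquandle9 : Biquandle (Fin 9) :=
  ofTables
    [[0, 4, 8, 7, 2, 3, 5, 6, 1], [4, 8, 0, 2, 3, 7, 6, 1, 5], [8, 0, 4, 3, 7, 2, 1, 5, 6],
      [3, 7, 2, 1, 5, 6, 8, 0, 4], [7, 2, 3, 5, 6, 1, 0, 4, 8], [2, 3, 7, 6, 1, 5, 4, 8, 0],
      [6, 1, 5, 4, 8, 0, 2, 3, 7], [1, 5, 6, 8, 0, 4, 3, 7, 2], [5, 6, 1, 0, 4, 8, 7, 2, 3]]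
    [[0, 1, 2, 7, 8, 6, 5, 3, 4], [7, 8, 6, 5, 3, 4, 0, 1, 2], [5, 3, 4, 0, 1, 2, 7, 8, 6],
      [3, 4, 5, 1, 2, 0, 8, 6, 7], [1, 2, 0, 8, 6, 7, 3, 4, 5], [8, 6, 7, 3, 4, 5, 1, 2, 0],
      [6, 7, 8, 4, 5, 3, 2, 0, 1], [4, 5, 3, 2, 0, 1, 6, 7, 8], [2, 0, 1, 6, 7, 8, 4, 5, 3]]
    [[0, 2, 1, 8, 7, 6, 4, 3, 5], [7, 6, 8, 3, 5, 4, 2, 1, 0], [5, 4, 3, 1, 0, 2, 6, 8, 7],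
      [3, 5, 4, 2, 1, 0, 7, 6, 8], [1, 0, 2, 6, 8, 7, 5, 4, 3], [8, 7, 6, 4, 3, 5, 0, 2, 1],
      [6, 8, 7, 5, 4, 3, 1, 0, 2], [4, 3, 5, 0, 2, 1, 8, 7, 6], [2, 1, 0, 7, 6, 8, 3, 5, 4]]
    [[0, 4, 8, 3, 7, 2, 6, 1, 5], [8, 0, 4, 2, 3, 7, 5, 6, 1], [4, 8, 0, 7, 2, 3, 1, 5, 6],
      [2, 3, 7, 5, 6, 1, 8, 0, 4], [7, 2, 3, 1, 5, 6, 4, 8, 0], [3, 7, 2, 6, 1, 5, 0, 4, 8],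
      [1, 5, 6, 4, 8, 0, 7, 2, 3], [6, 1, 5, 0, 4, 8, 3, 7, 2], [5, 6, 1, 8, 0, 4, 2, 3, 7]]
    [[0, 6, 3, 1, 7, 4, 2, 8, 5], [6, 3, 0, 7, 4, 1, 8, 5, 2], [3, 0, 6, 4, 1, 7, 5, 2, 8],
      [7, 4, 1, 8, 5, 2, 6, 3, 0], [4, 1, 7, 5, 2, 8, 3, 0, 6], [1, 7, 4, 2, 8, 5, 0, 6, 3],
      [5, 2, 8, 3, 0, 6, 4, 1, 7], [2, 8, 5, 0, 6, 3, 1, 7, 4], [8, 5, 2, 6, 3, 0, 7, 4, 1]]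
    [[0, 5, 7, 2, 4, 6, 1, 3, 8], [1, 3, 8, 0, 5, 7, 2, 4, 6], [2, 4, 6, 1, 3, 8, 0, 5, 7],
      [6, 2, 4, 8, 1, 3, 7, 0, 5], [7, 0, 5, 6, 2, 4, 8, 1, 3], [8, 1, 3, 7, 0, 5, 6, 2, 4],
      [3, 8, 1, 5, 7, 0, 4, 6, 2], [4, 6, 2, 3, 8, 1, 5, 7, 0], [5, 7, 0, 4, 6, 2, 3, 8, 1]]
    [0, 3, 6, 8, 2, 5, 4, 7, 1]
    (by decide +kernel) (by decide +kernel) (by decide) (by decide) (by decide) (by decide +kernel)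

end Biquandle

end VirtualKnot

namespace VirtualKnot

/-! ### Parity of crossings -/

/-- The crossing of `x` is odd: there is an even distance between its two passages. -/
def IsOddAt (w : List Passage) (x : Passage) : Prop := w.idxOf x % 2 = w.idxOf x.mate % 2

instance (w : List Passage) (x : Passage) : Decidable (IsOddAt w x) :=
  inferInstanceAs (Decidable (_ = _))

/-- The code without the odd crossings. -/
def evenPart (w : List Passage) : List Passage := w.filter fun x => ¬ IsOddAt w x

/-- The sum of the signs of the odd crossings. -/
def oddSum (w : List Passage) : ℤ :=
  ((w.filter fun x => x.upper ∧ IsOddAt w x).map Passage.sign).sum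

@[simp] theorem Passage.mate_mate (x : Passage) : x.mate.mate = x := by
  simp [Passage.mate]

theorem Passage.mate_ne (x : Passage) : x.mate ≠ x := fun h => by
  have := congrArg Passage.upper h
  simp [Passage.mate] at this

theorem isOddAt_mate {w : List Passage} {x : Passage} : IsOddAt w x.mate ↔ IsOddAt w x := by
  simp only [IsOddAt, Passage.mate_mate]
  exact eq_comm

/-- `Passage.mate` is a bijection between upper and lower passages. Evenness makes the parity of a
cyclic distance well defined. -/
theorem IsGaussCode.even_length {w : List Passage} (h : IsGaussCode w) : Even w.length := by
  have hp : ((w.filter fun x => x.upper).map Passage.mate).Perm (w.filter fun x => !x.upper) := by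
    refine (List.perm_ext_iff_of_nodup ?_ (h.1.filter _)).2 fun x => ?_
    · exact (h.1.filter _).map fun x y hxy => by simpa using congrArg Passage.mate hxy
    · simp only [List.mem_map, List.mem_filter]
      constructor
      · rintro ⟨y, ⟨hy, hy'⟩, rfl⟩
        exact ⟨(h.2 y hy).1, by simpa [Passage.mate] using hy'⟩
      · rintro ⟨hx, hx'⟩
        exact ⟨x.mate, ⟨(h.2 x hx).1, by simpa [Passage.mate] using hx'⟩, x.mate_mate⟩
  have := hp.length_eq
  rw [List.length_map] at this
  rw [List.length_eq_length_filter_add (fun x : Passage => x.upper) (l := w), ← this]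
  exact ⟨_, rfl⟩

theorem IsGaussCode.filter {w : List Passage} (h : IsGaussCode w) (p : Passage → Bool)
    (hp : ∀ x, p x.mate = p x) : IsGaussCode (w.filter p) := by
  refine ⟨h.1.filter _, fun x hx => ?_⟩
  obtain ⟨hx, hx'⟩ := List.mem_filter.1 hx
  obtain ⟨h1, h2⟩ := h.2 x hx
  exact ⟨List.mem_filter.2 ⟨h1, by rwa [hp]⟩, fun y hy => h2 y (List.mem_filter.1 hy).1⟩

theorem IsGaussCode.evenPart {w : List Passage} (h : IsGaussCode w) : IsGaussCode (evenPart w) :=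
  h.filter _ fun x => by simp only [isOddAt_mate]

theorem idxOf_pair_left {x y : Passage} (h : x ≠ y) (t : Bool) :
    (pair t x y).idxOf x = if t then 0 else 1 := by
  cases t <;> simp [pair, h.symm]

theorem idxOf_pair_right {x y : Passage} (h : x ≠ y) (t : Bool) :
    (pair t x y).idxOf y = if t then 1 else 0 := by
  cases t <;> simp [pair, h]

/-- Parities of positions do not change if a word of even length is inserted. -/
theorem idxOf_insert_mod_two {u p v : List Passage} {x : Passage} (hp : Even p.length) (hx : x ∉ p) :
    (u ++ p ++ v).idxOf x % 2 = (u ++ v).idxOf x % 2 := by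
  obtain ⟨k, hk⟩ := hp
  by_cases hu : x ∈ u
  · rw [List.append_assoc, List.idxOf_append, if_pos hu, List.idxOf_append, if_pos hu]
  · rw [List.idxOf_append_of_notMem (by simp [hu, hx]), List.idxOf_append_of_notMem hu, List.length_append]
    omega

theorem evenPart_eq_self {w : List Passage} (h : ∀ x ∈ w, ¬ IsOddAt w x) : evenPart w = w := by
  simpa [evenPart] using h

theorem oddSum_eq_zero {w : List Passage} (h : ∀ x ∈ w, ¬ IsOddAt w x) : oddSum w = 0 := by
  have : (w.filter fun x => x.upper ∧ IsOddAt w x) = [] := by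
    rw [List.filter_eq_nil_iff]
    intro x hx
    simp [h x hx]
  rw [oddSum, this]
  rfl

/-- The number of crossings met is the cyclic distance minus one, and wrapping around the code of
even length does not change its parity. -/
theorem odd_encountered_iff {w : List Passage} (h : IsGaussCode w) {x : Passage} (hx : x ∈ w) :
    Odd (encountered w x) ↔ IsOddAt w x := by
  obtain ⟨k, hk⟩ := h.even_length
  have hi : w.idxOf x < w.length := List.idxOf_lt_length_iff.2 hx
  have hj : w.idxOf x.mate < w.length := List.idxOf_lt_length_iff.2 (h.2 x hx).1
  have hij : w.idxOf x ≠ w.idxOf x.mate := fun e => x.mate_ne (List.idxOf_inj (h.2 x hx).1 |>.1 e.symm)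
  rw [encountered, IsOddAt, Nat.odd_iff]
  generalize w.idxOf x = i at *
  generalize w.idxOf x.mate = j at *
  generalize w.length = n at *
  rcases lt_or_gt_of_ne hij with h' | h'
  · have e : (j + (n - i)) % n = j - i := by
      rw [show j + (n - i) = j - i + n by omega, Nat.add_mod_right, Nat.mod_eq_of_lt (by omega)]
    rw [e]
    omega
  · have e : (j + (n - i)) % n = j + (n - i) := Nat.mod_eq_of_lt (by omega)
    rw [e]
    omega

theorem oddWrithe_eq_oddSum (D : GaussDiagram) : oddWrithe D = oddSum D.code := by
  rw [oddWrithe, oddSum]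
  congr 2
  refine List.filter_congr fun x hx => ?_
  simp only [odd_encountered_iff D.valid hx]

theorem Side.eq_iff_of_ne {a b d : Side} (h : b ≠ a) : b = d ↔ ¬ a = d := by
  cases a <;> cases b <;> cases d <;> simp_all

/-- In a checkerboard colorable diagram all crossings are even. -/
theorem DiagramColorable.not_isOddAt {D : GaussDiagram} (h : DiagramColorable D) {x : Passage}
    (hx : x ∈ D.code) : ¬ IsOddAt D.code x := by
  obtain ⟨c, hc⟩ := h
  obtain ⟨w, hw⟩ := D
  dsimp only at hx ⊢
  -- One of the two passages of a crossing comes in from the left, and the coloring condition there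
  -- covers both.
  have key : ∀ x ∈ w, c x.mate ≠ c x ∧ c (next w x) ≠ c x := by
    intro x hx
    by_cases hl : FromLeft x
    · rcases hc x hx hl with ⟨h1, h2, h3, h4⟩ | ⟨h1, h2, h3, h4⟩ <;> simp [h1, h2, h4]
    · have hl' : FromLeft x.mate := by
        unfold FromLeft Passage.mate at *
        revert hl
        cases x.upper <;> cases x.pos <;> simp
      rcases hc _ (hw.2 x hx).1 hl' with ⟨h1, h2, h3, h4⟩ | ⟨h1, h2, h3, h4⟩ <;>
        rw [Passage.mate_mate] at h2 h3 <;> simp [h1, h2, h3]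
  -- The mark flips at each crossing, so it is determined by the parity of the position; mates have
  -- different marks and therefore positions of different parity.
  have step : ∀ k (hk : k < w.length), (c w[k] = c (w[0]'(by omega)) ↔ k % 2 = 0) := by
    intro k
    induction k with
    | zero => simp
    | succ k ih =>
      intro hk
      have ih := ih (by omega)
      have e : next w w[k] = w[k + 1] := by
        have : w.idxOf w[k] = k := List.Nodup.idxOf_getElem hw.1 k (by omega)
        rw [next, this, Nat.mod_eq_of_lt hk, List.getD_eq_getElem _ _ hk]
      have h1 := (key w[k] (List.getElem_mem _)).2
      rw [e] at h1
      generalize c w[k] = a at *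
      generalize c w[k + 1] = b at *
      generalize c w[0] = d at *
      rw [Side.eq_iff_of_ne h1, ih]
      omega
  intro ho
  have hi : w.idxOf x < w.length := List.idxOf_lt_length_iff.2 hx
  have hj : w.idxOf x.mate < w.length := List.idxOf_lt_length_iff.2 (hw.2 x hx).1
  have h1 := step _ hi
  have h2 := step _ hj
  rw [List.getElem_idxOf hi] at h1
  rw [List.getElem_idxOf hj] at h2
  have h3 := (key x hx).1
  rw [IsOddAt] at ho
  rw [← ho, ← h1] at h2
  exact not_iff_self ((Side.eq_iff_of_ne h3).symm.trans h2)

end VirtualKnot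

/-! ### Deletion of odd crossings under base point change, renaming and the first two moves -/

namespace VirtualKnot

/-- A move changes the even part of a code by at most a move, and preserves the sum of the signs of the
odd crossings. -/
def ParityInvariant (w w' : List Passage) : Prop :=
  (evenPart w = evenPart w' ∨ Move (evenPart w) (evenPart w')) ∧ oddSum w = oddSum w'

/-- Parity of a crossing only depends on a difference of positions, so a common shift `k` is
harmless. -/
theorem isOddAt_congr {w w' : List Passage} {x : Passage} {k : ℕ}
    (h : w.idxOf x % 2 = (w'.idxOf x + k) % 2)
    (h' : w.idxOf x.mate % 2 = (w'.idxOf x.mate + k) % 2) : IsOddAt w x ↔ IsOddAt w' x := by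
  unfold IsOddAt
  omega

theorem oddSum_eq_of_perm {w w' : List Passage} (hp : w.Perm w')
    (h : ∀ x ∈ w, (IsOddAt w x ↔ IsOddAt w' x)) : oddSum w = oddSum w' := by
  have e : (w.filter fun x => x.upper ∧ IsOddAt w x) = w.filter fun x => x.upper ∧ IsOddAt w' x :=
    List.filter_congr fun x hx => by simp only [h x hx]
  rw [oddSum, oddSum, e]
  exact ((hp.filter _).map _).sum_eq

theorem evenPart_eq_filter {w w' : List Passage} (h : ∀ x ∈ w, (IsOddAt w x ↔ IsOddAt w' x)) :
    evenPart w = w.filter fun x => ¬ IsOddAt w' x :=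
  List.filter_congr fun x hx => by simp only [h x hx]

/-- Positions in `u` are shifted by the length of `v` and those in `v` by minus the length of `u`;
these agree modulo two because the total length is even. -/
theorem parityInvariant_rotate {u v : List Passage} (h : IsGaussCode (u ++ v)) :
    ParityInvariant (u ++ v) (v ++ u) := by
  have hd := List.nodup_append'.1 h.1
  have hl := h.even_length
  rw [List.length_append, Nat.even_iff] at hl
  have key : ∀ x ∈ u ++ v, (u ++ v).idxOf x % 2 = ((v ++ u).idxOf x + u.length) % 2 := by
    intro x hx
    rcases List.mem_append.1 hx with hx | hx
    · rw [List.idxOf_append_of_mem hx, List.idxOf_append_of_notMem (hd.2.2 hx)]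
      omega
    · rw [List.idxOf_append_of_mem hx, List.idxOf_append_of_notMem fun h' => hd.2.2 h' hx]
      omega
  have e : ∀ x ∈ u ++ v, (IsOddAt (u ++ v) x ↔ IsOddAt (v ++ u) x) := fun x hx =>
    isOddAt_congr (key x hx) (key _ (h.2 x hx).1)
  refine ⟨.inr ?_, oddSum_eq_of_perm List.perm_append_comm e⟩
  rw [evenPart_eq_filter e, evenPart, List.filter_append, List.filter_append]
  exact .rotate _ _

theorem rename_injective {f : ℕ → ℕ} (hf : Function.Injective f) :
    Function.Injective (Passage.rename f) := by
  rintro ⟨a, o, s⟩ ⟨b, o', s'⟩ h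
  simp only [Passage.rename, Passage.mk.injEq] at h ⊢
  exact ⟨hf h.1, h.2⟩

theorem idxOf_map_of_injective {f : Passage → Passage} (hf : Function.Injective f) (x : Passage)
    (w : List Passage) : (w.map f).idxOf (f x) = w.idxOf x := by
  induction w with
  | nil => rfl
  | cons y w ih => simp [List.idxOf_cons, ih, hf.eq_iff, beq_eq_decide]

theorem parityInvariant_rename {f : ℕ → ℕ} (hf : Function.Injective f) (w : List Passage) :
    ParityInvariant w (w.map (Passage.rename f)) := by
  have e : ∀ x, (IsOddAt (w.map (Passage.rename f)) (x.rename f) ↔ IsOddAt w x) := fun x => by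
    have h := idxOf_map_of_injective (rename_injective hf) x.mate w
    rw [IsOddAt, IsOddAt, idxOf_map_of_injective (rename_injective hf), ← h]
    rfl
  refine ⟨.inr ?_, ?_⟩
  · have : evenPart (w.map (Passage.rename f)) = (evenPart w).map (Passage.rename f) := by
      rw [evenPart, evenPart, List.filter_map]
      congr 1
      exact List.filter_congr fun x _ => by simp [e]
    rw [this]
    exact .rename f hf _
  · rw [oddSum, oddSum, List.filter_map, List.map_map]
    congr 1
    refine List.map_congr_left (fun x _ => rfl) |>.trans (congrArg _ ?_) |>.symm
    exact List.filter_congr fun x _ => by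
      simp only [Function.comp, e]
      rfl

/-- The passages of a kink are adjacent, so its crossing is even and is never deleted. -/
theorem parityInvariant_reidemeister1 {a : ℕ} (o s : Bool) {w : List Passage} (ha : Fresh a w)
    (h : IsGaussCode w) : ParityInvariant w (⟨a, o, s⟩ :: ⟨a, !o, s⟩ :: w) := by
  have hx : ¬ IsOddAt (⟨a, o, s⟩ :: ⟨a, !o, s⟩ :: w) ⟨a, o, s⟩ := by
    simp [IsOddAt, Passage.mate]
  have hx' : ¬ IsOddAt (⟨a, o, s⟩ :: ⟨a, !o, s⟩ :: w) ⟨a, !o, s⟩ :=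
    mt (isOddAt_mate (x := ⟨a, o, s⟩)).1 hx
  have key : ∀ x ∈ w, w.idxOf x % 2 = ((⟨a, o, s⟩ :: ⟨a, !o, s⟩ :: w : List Passage).idxOf x + 0) % 2 := by
    intro x hx
    have := ha x hx
    have h1 : (⟨a, o, s⟩ : Passage) ≠ x := by rintro rfl; exact this rfl
    have h2 : (⟨a, !o, s⟩ : Passage) ≠ x := by rintro rfl; exact this rfl
    rw [List.idxOf_cons_ne _ h1, List.idxOf_cons_ne _ h2]
    omega
  have e : ∀ x ∈ w, (IsOddAt w x ↔ IsOddAt (⟨a, o, s⟩ :: ⟨a, !o, s⟩ :: w) x) := fun x hx =>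
    isOddAt_congr (key x hx) (key _ (h.2 x hx).1)
  refine ⟨.inr ?_, ?_⟩
  · have : evenPart (⟨a, o, s⟩ :: ⟨a, !o, s⟩ :: w) = ⟨a, o, s⟩ :: ⟨a, !o, s⟩ :: evenPart w := by
      rw [evenPart_eq_filter e, evenPart, List.filter_cons_of_pos (by simpa using hx),
        List.filter_cons_of_pos (by simpa using hx')]
    rw [this]
    exact .reidemeister1 a o s _ fun x hx => ha x (List.mem_of_mem_filter hx)
  · rw [oddSum, oddSum, List.filter_cons_of_neg (by simpa using fun _ => hx),
      List.filter_cons_of_neg (by simpa using fun _ => hx')]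
    congr 2
    exact List.filter_congr fun x hx => by simp only [e x hx]

theorem filter_pair_of_mem {p : Passage → Bool} {t : Bool} {x y : Passage} (hx : p x) (hy : p y) :
    (pair t x y).filter p = pair t x y := by
  cases t <;> simp [pair, hx, hy]

theorem filter_pair_of_notMem {p : Passage → Bool} {t : Bool} {x y : Passage} (hx : ¬ p x)
    (hy : ¬ p y) : (pair t x y).filter p = [] := by
  cases t <;> simp [pair, hx, hy]

theorem filter_pair_not {p : Passage → Bool} {x y : Passage} (h : ¬ (p x ∧ p y)) (t : Bool) :
    (pair (!t) x y).filter p = (pair t x y).filter p := by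
  cases t <;> by_cases hx : p x <;> by_cases hy : p y <;> simp_all [pair]

/-- The two new crossings have equal parity. If they are even, the move survives the deletion; if
they are odd, both disappear, and their opposite signs cancel in the sum. -/
theorem parityInvariant_reidemeister2 {a b : ℕ} (s t : Bool) {u v : List Passage} (hab : a ≠ b)
    (ha : Fresh a (u ++ v)) (hb : Fresh b (u ++ v)) (h : IsGaussCode (u ++ v)) :
    ParityInvariant (u ++ v)
      (pair true ⟨a, true, s⟩ ⟨b, true, !s⟩ ++ u ++ pair t ⟨a, false, s⟩ ⟨b, false, !s⟩ ++ v) := by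
  set w := pair true ⟨a, true, s⟩ ⟨b, true, !s⟩ ++ u ++ pair t ⟨a, false, s⟩ ⟨b, false, !s⟩ ++ v
    with hw
  have key : ∀ x ∈ u ++ v, (u ++ v).idxOf x % 2 = (w.idxOf x + 0) % 2 := by
    intro x hx
    have hxa := ha x hx
    have hxb := hb x hx
    have h1 : ∀ o, x ≠ ⟨a, o, s⟩ := fun o e => hxa (congrArg Passage.label e)
    have h2 : ∀ o, x ≠ ⟨b, o, !s⟩ := fun o e => hxb (congrArg Passage.label e)
    rw [add_zero, hw, idxOf_insert_mod_two ⟨1, length_pair⟩ (by simp [mem_pair, h1, h2]),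
      List.append_assoc, ← List.nil_append (pair _ _ _ ++ (u ++ v)), ← List.append_assoc,
      idxOf_insert_mod_two ⟨1, length_pair⟩ (by simp [mem_pair, h1, h2]), List.nil_append]
  have e : ∀ x ∈ u ++ v, (IsOddAt (u ++ v) x ↔ IsOddAt w x) := fun x hx =>
    isOddAt_congr (key x hx) (key _ (h.2 x hx).1)
  have nab : ∀ o o' s s', (⟨a, o, s⟩ : Passage) ≠ ⟨b, o', s'⟩ := fun _ _ _ _ e =>
    hab (congrArg Passage.label e)
  have nmem : ∀ d, Fresh d (u ++ v) → ∀ o s, (⟨d, o, s⟩ : Passage) ∉ u ∧ (⟨d, o, s⟩ : Passage) ∉ v :=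
    fun d hd o s => ⟨fun h => hd _ (List.mem_append_left _ h) rfl,
      fun h => hd _ (List.mem_append_right _ h) rfl⟩
  have ia : w.idxOf ⟨a, true, s⟩ = 0 := by simp [hw, pair]
  have ib : w.idxOf ⟨b, true, !s⟩ = 1 := by simp [hw, pair, nab]
  have ia' : w.idxOf ⟨a, false, s⟩ = 2 + u.length + if t then 0 else 1 := by
    rw [hw, List.append_assoc, List.idxOf_append_of_notMem (by simp [mem_pair, nab, nmem a ha]),
      List.idxOf_append_of_mem (by simp [mem_pair]), idxOf_pair_left (nab _ _ _ _), List.length_append,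
      length_pair]
  have ib' : w.idxOf ⟨b, false, !s⟩ = 2 + u.length + if t then 1 else 0 := by
    rw [hw, List.append_assoc, List.idxOf_append_of_notMem (by simp [mem_pair, (nab _ _ _ _).symm, nmem b hb]),
      List.idxOf_append_of_mem (by simp [mem_pair]), idxOf_pair_right (nab _ _ _ _), List.length_append,
      length_pair]
  have hiff : IsOddAt w ⟨a, true, s⟩ ↔ IsOddAt w ⟨b, true, !s⟩ := by
    simp only [IsOddAt, Passage.mate, Bool.not_true, ia, ib, ia', ib']
    cases t <;> simp <;> omega
  have ma : IsOddAt w ⟨a, false, s⟩ ↔ IsOddAt w ⟨a, true, s⟩ := isOddAt_mate (x := ⟨a, true, s⟩)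
  have mb : IsOddAt w ⟨b, false, !s⟩ ↔ IsOddAt w ⟨b, true, !s⟩ := isOddAt_mate (x := ⟨b, true, !s⟩)
  have ef : ∀ p : Passage → Bool, w.filter p = (pair true ⟨a, true, s⟩ ⟨b, true, !s⟩).filter p ++
      u.filter p ++ (pair t ⟨a, false, s⟩ ⟨b, false, !s⟩).filter p ++ v.filter p := fun p => by
    rw [hw]
    simp only [List.filter_append]
  have eo' : oddSum (u ++ v) = ((u.filter (fun x => x.upper ∧ IsOddAt w x) ++
      v.filter (fun x => x.upper ∧ IsOddAt w x)).map Passage.sign).sum := by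
    rw [oddSum, ← List.filter_append]
    congr 2
    exact List.filter_congr fun x hx => by simp only [e x hx]
  constructor
  · rw [evenPart_eq_filter e, evenPart, ef, List.filter_append]
    by_cases hodd : IsOddAt w ⟨a, true, s⟩
    · left
      rw [filter_pair_of_notMem (by simpa using hodd) (by simpa using hiff.1 hodd),
        filter_pair_of_notMem (by simpa using ma.2 hodd) (by simpa using mb.2 (hiff.1 hodd))]
      simp
    · right
      rw [filter_pair_of_mem (by simpa using hodd) (by simpa using mt hiff.2 hodd),
        filter_pair_of_mem (by simpa using mt ma.1 hodd) (by simpa using mt (hiff.2 ∘ mb.1) hodd)]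
      rw [← List.filter_append]
      have := Move.reidemeister2 a b s t (u.filter (fun x => ¬ IsOddAt w x))
        (v.filter (fun x => ¬ IsOddAt w x)) hab
        (by rw [← List.filter_append]; exact fun x hx => ha x (List.mem_of_mem_filter hx))
        (by rw [← List.filter_append]; exact fun x hx => hb x (List.mem_of_mem_filter hx))
      rwa [← List.filter_append] at this
  · rw [eo', oddSum, ef]
    have h0 : (pair t ⟨a, false, s⟩ ⟨b, false, !s⟩).filter (fun x => x.upper ∧ IsOddAt w x) = [] :=
      filter_pair_of_notMem (by simp) (by simp)
    rw [h0]
    by_cases hodd : IsOddAt w ⟨a, true, s⟩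
    · rw [filter_pair_of_mem (by simpa using hodd) (by simpa using hiff.1 hodd)]
      simp only [List.map_append, List.sum_append]
      cases s <;> simp [pair, Passage.sign]
    · rw [filter_pair_of_notMem (by simpa using hodd) (by simpa using mt hiff.2 hodd)]
      simp
end VirtualKnot

/-! ### Deletion of odd crossings under the third Reidemeister move -/

namespace VirtualKnot

/-- Three pairs of passages, separated by three words. -/
def threePairs (x y x' y' x'' y'' : Passage) (t t' t'' : Bool) (u v w : List Passage) : List Passage :=
  pair t x y ++ u ++ pair t' x' y' ++ v ++ pair t'' x'' y'' ++ w

theorem pair_not_swap (t : Bool) (x y : Passage) : pair (!t) y x = pair t x y := by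
  cases t <;> rfl

section

variable {x y x' y' x'' y'' : Passage} {t t' t'' : Bool} {u v w : List Passage}

theorem perm_threePairs :
    (threePairs x y x' y' x'' y'' t t' t'' u v w).Perm ([x, y, x', y', x'', y''] ++ (u ++ v ++ w)) := by
  rw [List.perm_iff_count]
  intro z
  simp only [threePairs, List.count_append, count_pair, List.count_cons, List.count_nil]
  omega

theorem idxOf_threePairs_of_notMem {z : Passage} (hz : z ∉ [x, y, x', y', x'', y'']) :
    (threePairs x y x' y' x'' y'' t t' t'' u v w).idxOf z % 2 = (u ++ v ++ w).idxOf z % 2 := by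
  simp only [List.mem_cons, List.not_mem_nil, or_false, not_or] at hz
  have e1 := idxOf_insert_mod_two (u := pair t x y ++ u ++ pair t' x' y' ++ v) (p := pair t'' x'' y'')
    (v := w) (x := z) ⟨1, length_pair⟩ (by simp [mem_pair, hz])
  have e2 := idxOf_insert_mod_two (u := pair t x y ++ u) (p := pair t' x' y')
    (v := v ++ w) (x := z) ⟨1, length_pair⟩ (by simp [mem_pair, hz])
  have e3 := idxOf_insert_mod_two (u := []) (p := pair t x y)
    (v := u ++ (v ++ w)) (x := z) ⟨1, length_pair⟩ (by simp [mem_pair, hz])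
  simp only [List.append_assoc, List.nil_append] at e1 e2 e3
  simp only [threePairs, List.append_assoc]
  rw [e1, e2, e3]

theorem idxOf_threePairs (h : ([x, y, x', y', x'', y''] ++ (u ++ v ++ w)).Nodup) :
    let W := threePairs x y x' y' x'' y'' t t' t'' u v w
    (W.idxOf x = (if t then 0 else 1) ∧ W.idxOf y = if t then 1 else 0) ∧
    (W.idxOf x' = 2 + u.length + (if t' then 0 else 1) ∧
      W.idxOf y' = 2 + u.length + if t' then 1 else 0) ∧
    (W.idxOf x'' = 4 + u.length + v.length + (if t'' then 0 else 1) ∧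
      W.idxOf y'' = 4 + u.length + v.length + if t'' then 1 else 0) := by
  simp only [List.cons_append, List.nil_append, List.nodup_cons, List.mem_cons, List.mem_append,
    not_or] at h
  obtain ⟨hx, hy, hx', hy', hx'', hy'', -⟩ := h
  have e : ∀ (p q r : List Passage) (z : Passage), z ∉ p → z ∈ q →
      (p ++ (q ++ r)).idxOf z = p.length + q.idxOf z := fun p q r z h1 h2 => by
    rw [List.idxOf_append_of_notMem h1, List.idxOf_append_of_mem h2]
  have l1 : (pair t x y ++ u).length = 2 + u.length := by rw [List.length_append, length_pair]
  have l2 : (pair t x y ++ u ++ pair t' x' y' ++ v).length = 4 + u.length + v.length := by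
    simp only [List.length_append, length_pair]
    omega
  refine ⟨⟨?_, ?_⟩, ⟨?_, ?_⟩, ?_, ?_⟩
  · rw [← idxOf_pair_left hx.1 t]
    simp only [threePairs, List.append_assoc]
    exact List.idxOf_append_of_mem (by simp [mem_pair])
  · rw [← idxOf_pair_right hx.1 t]
    simp only [threePairs, List.append_assoc]
    exact List.idxOf_append_of_mem (by simp [mem_pair])
  · rw [← idxOf_pair_left hx'.1 t', ← l1, threePairs, List.append_assoc, List.append_assoc,
      List.append_assoc]
    exact e _ _ _ _ (by simp [mem_pair]; grind) (by simp [mem_pair])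
  · rw [← idxOf_pair_right hx'.1 t', ← l1, threePairs, List.append_assoc, List.append_assoc,
      List.append_assoc]
    exact e _ _ _ _ (by simp [mem_pair]; grind) (by simp [mem_pair])
  · rw [← idxOf_pair_left hx''.1 t'', ← l2, threePairs, List.append_assoc]
    exact e _ _ _ _ (by simp [mem_pair]; grind) (by simp [mem_pair])
  · rw [← idxOf_pair_right hx''.1 t'', ← l2, threePairs, List.append_assoc]
    exact e _ _ _ _ (by simp [mem_pair]; grind) (by simp [mem_pair])

theorem filter_threePairs (p : Passage → Bool) :
    (threePairs x y x' y' x'' y'' t t' t'' u v w).filter p =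
      (pair t x y).filter p ++ u.filter p ++ (pair t' x' y').filter p ++ v.filter p ++
        (pair t'' x'' y'').filter p ++ w.filter p := by
  simp only [threePairs, List.filter_append]

/-- By `h`, two surviving crossings force the third to survive. So either all three pairs remain, or
no pair remains whole and reversing the pairs has no effect. -/
theorem filter_threePairs_not {p : Passage → Bool} (hx : p x' = p x) (hy : p x'' = p y)
    (hy' : p y'' = p y') (h : p x ↔ (p y ↔ p y')) :
    (threePairs x y x' y' x'' y'' t t' t'' u v w).filter p =
      (threePairs x y x' y' x'' y'' (!t) (!t') (!t'') u v w).filter p ∨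
    ∃ u' v' w', (threePairs x y x' y' x'' y'' t t' t'' u v w).filter p =
        threePairs x y x' y' x'' y'' t t' t'' u' v' w' ∧
      (threePairs x y x' y' x'' y'' (!t) (!t') (!t'') u v w).filter p =
        threePairs x y x' y' x'' y'' (!t) (!t') (!t'') u' v' w' := by
  rw [filter_threePairs, filter_threePairs]
  by_cases hc : p x ∧ p y
  · right
    have hc' := (h.1 hc.1).1 hc.2
    refine ⟨u.filter p, v.filter p, w.filter p, ?_, ?_⟩ <;>
      rw [filter_pair_of_mem hc.1 hc.2, filter_pair_of_mem (hx.trans hc.1) hc',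
        filter_pair_of_mem (hy.trans hc.2) (hy'.trans hc'), threePairs]
  · left
    rw [filter_pair_not hc, filter_pair_not (by rw [hx]; tauto),
      filter_pair_not (by rw [hy, hy']; tauto)]

/-- Reversing three pairs of passages through three crossings does not change parities. Either all three
crossings are even, or exactly one of them is. -/
theorem parity_threePairs (h : IsGaussCode (threePairs x y x' y' x'' y'' t t' t'' u v w))
    (hx : x.mate = x') (hy : y.mate = x'') (hy' : y'.mate = y'') :
    oddSum (threePairs x y x' y' x'' y'' t t' t'' u v w) =
      oddSum (threePairs x y x' y' x'' y'' (!t) (!t') (!t'') u v w) ∧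
    (evenPart (threePairs x y x' y' x'' y'' t t' t'' u v w) =
      evenPart (threePairs x y x' y' x'' y'' (!t) (!t') (!t'') u v w) ∨
    ∃ u' v' w', evenPart (threePairs x y x' y' x'' y'' t t' t'' u v w) =
        threePairs x y x' y' x'' y'' t t' t'' u' v' w' ∧
      evenPart (threePairs x y x' y' x'' y'' (!t) (!t') (!t'') u v w) =
        threePairs x y x' y' x'' y'' (!t) (!t') (!t'') u' v' w') := by
  have hn := (h.perm perm_threePairs).1
  have i := idxOf_threePairs (t := t) (t' := t') (t'' := t'') hn
  have i' := idxOf_threePairs (t := !t) (t' := !t') (t'' := !t'') hn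
  have hm : ∀ z ∈ threePairs x y x' y' x'' y'' t t' t'' u v w,
      z ∉ [x, y, x', y', x'', y''] → z.mate ∉ [x, y, x', y', x'', y''] := by
    intro z _ hz hz'
    subst hx hy hy'
    refine hz ?_
    have : z = z.mate.mate := z.mate_mate.symm
    simp only [List.mem_cons, List.not_mem_nil, or_false] at hz' ⊢
    rcases hz' with h | h | h | h | h | h <;> rw [h] at this <;> simp [this]
  have o : ∀ z ∈ threePairs x y x' y' x'' y'' t t' t'' u v w,
      z ∉ [x, y, x', y', x'', y''] → (IsOddAt (threePairs x y x' y' x'' y'' t t' t'' u v w) z ↔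
        IsOddAt (threePairs x y x' y' x'' y'' (!t) (!t') (!t'') u v w) z) := by
    intro z hz hz'
    unfold IsOddAt
    rw [idxOf_threePairs_of_notMem hz', idxOf_threePairs_of_notMem hz',
      idxOf_threePairs_of_notMem (hm z hz hz'), idxOf_threePairs_of_notMem (hm z hz hz')]
  set W := threePairs x y x' y' x'' y'' t t' t'' u v w with hW
  set W' := threePairs x y x' y' x'' y'' (!t) (!t') (!t'') u v w with hW'
  have n : ∀ b : Bool, (if (!b) = true then 0 else 1) = if b then 1 else 0 := by decide
  have n' : ∀ b : Bool, (if (!b) = true then 1 else 0) = if b then 0 else 1 := by decide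
  have ne : ∀ b : Bool, (if b = true then 1 else 0) + (if b = true then 0 else 1) = 1 := by decide
  have n1 := ne t
  have n2 := ne t'
  have n3 := ne t''
  simp only [n, n'] at i i'
  generalize (if t = true then 1 else 0) = b1 at *
  generalize (if t = true then 0 else 1) = c1 at *
  generalize (if t' = true then 1 else 0) = b2 at *
  generalize (if t' = true then 0 else 1) = c2 at *
  generalize (if t'' = true then 1 else 0) = b3 at *
  generalize (if t'' = true then 0 else 1) = c3 at *
  have ox : IsOddAt W x ↔ IsOddAt W' x := by unfold IsOddAt; rw [hx]; omega
  have oy : IsOddAt W y ↔ IsOddAt W' y := by unfold IsOddAt; rw [hy]; omega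
  have oy' : IsOddAt W y' ↔ IsOddAt W' y' := by unfold IsOddAt; rw [hy']; omega
  -- The three distances between mates have an odd sum: the lengths of `u` and `v` enter an even
  -- number of times, and each pair contributes one. So the number of even crossings is one or
  -- three.
  have ev : ¬ IsOddAt W x ↔ (¬ IsOddAt W y ↔ ¬ IsOddAt W y') := by
    unfold IsOddAt
    rw [hx, hy, hy']
    omega
  have m1 : ∀ V, IsOddAt V x' ↔ IsOddAt V x := fun V => hx ▸ isOddAt_mate
  have m2 : ∀ V, IsOddAt V x'' ↔ IsOddAt V y := fun V => hy ▸ isOddAt_mate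
  have m3 : ∀ V, IsOddAt V y'' ↔ IsOddAt V y' := fun V => hy' ▸ isOddAt_mate
  have hall : ∀ z ∈ W, (IsOddAt W z ↔ IsOddAt W' z) := by
    intro z hz
    by_cases hz' : z ∈ [x, y, x', y', x'', y'']
    · simp only [List.mem_cons, List.not_mem_nil, or_false] at hz'
      rcases hz' with rfl | rfl | rfl | rfl | rfl | rfl
      exacts [ox, oy, (m1 _).trans (ox.trans (m1 _).symm), oy', (m2 _).trans (oy.trans (m2 _).symm),
        (m3 _).trans (oy'.trans (m3 _).symm)]
    · exact o z hz hz'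
  refine ⟨oddSum_eq_of_perm (perm_threePairs.trans perm_threePairs.symm) hall, ?_⟩
  rw [evenPart_eq_filter hall, evenPart]
  rw [hW, hW']
  refine filter_threePairs_not ?_ ?_ ?_ ?_
  · simp only [m1]
  · simp only [m2]
  · simp only [m3]
  · simp only [decide_eq_true_eq]
    rwa [← ox, ← oy, ← oy']

end

theorem parityInvariant_move {w w' : List Passage} (h : Move w w') (hw : IsGaussCode w) :
    ParityInvariant w w' := by
  cases h with
  | rotate u v => exact parityInvariant_rotate hw
  | rename f hf w => exact parityInvariant_rename hf w
  | reidemeister1 a o s w ha => exact parityInvariant_reidemeister1 o s ha hw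
  | reidemeister2 a b s t u v hab ha hb => exact parityInvariant_reidemeister2 s t hab ha hb hw
  | reidemeister3 a b c sa sb sc t m l u v w hab hac =>
    obtain ⟨h1, h2⟩ := parity_threePairs hw rfl rfl rfl
    refine ⟨h2.imp id ?_, h1⟩
    rintro ⟨u', v', w', h3, h4⟩
    have := Move.reidemeister3 a b c sa sb sc t m l u' v' w' hab hac
    change Move (threePairs ..) (threePairs ..) at this
    exact h3 ▸ h4 ▸ this
  | reidemeister3' a b c sa sb sc t m l u v w hab hac =>
    -- With the bottom strand second, the first passage listed in the top pair must be that of `b`,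
    -- to match the pattern of mates in `parity_threePairs`.
    rw [← pair_not_swap t ⟨a, true, sa⟩ ⟨b, true, sb⟩] at hw ⊢
    rw [← pair_not_swap (!t) ⟨a, true, sa⟩ ⟨b, true, sb⟩]
    obtain ⟨h1, h2⟩ := parity_threePairs hw rfl rfl rfl
    refine ⟨h2.imp id ?_, h1⟩
    rintro ⟨u', v', w', h3, h4⟩
    have := Move.reidemeister3' a b c sa sb sc t m l u' v' w' hab hac
    rw [← pair_not_swap t ⟨a, true, sa⟩ ⟨b, true, sb⟩, ← pair_not_swap (!t) ⟨a, true, sa⟩ ⟨b, true, sb⟩] at this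
    change Move (threePairs ..) (threePairs ..) at this
    exact h3 ▸ h4 ▸ this

end VirtualKnot

namespace VirtualKnot

/-! ### Invariants of virtual knots -/

theorem Equivalent.oddWrithe_eq {D E : GaussDiagram} (h : Equivalent D E) :
    oddWrithe D = oddWrithe E := by
  induction h with
  | rel D E h =>
    rw [oddWrithe_eq_oddSum, oddWrithe_eq_oddSum]
    exact (parityInvariant_move h D.valid).2
  | refl => rfl
  | symm _ _ _ ih => exact ih.symm
  | trans _ _ _ _ _ ih ih' => exact ih.trans ih'

variable {X : Type} [Inhabited X]

theorem Equivalent.coloring (B : Biquandle X) {D E : GaussDiagram} (h : Equivalent D E) :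
    Nonempty (B.Coloring D.code ≃ B.Coloring E.code) := by
  induction h with
  | rel D E h => exact B.coloring_move h D.valid
  | refl => exact ⟨Equiv.refl _⟩
  | symm _ _ _ ih => exact ih.map Equiv.symm
  | trans _ _ _ _ _ ih ih' => exact ih.map2 Equiv.trans ih'

theorem IsGaussCode.iterate_evenPart {w : List Passage} (h : IsGaussCode w) (n : ℕ) :
    IsGaussCode (VirtualKnot.evenPart^[n] w) := by
  induction n with
  | zero => exact h
  | succ n ih => exact Function.iterate_succ_apply' VirtualKnot.evenPart n w ▸ ih.evenPart

/-- Deletion has to be iterated because removing odd crossings changes positions and can make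
further crossings odd. -/
theorem iterate_evenPart_move {w w' : List Passage} (h : Move w w') (hw : IsGaussCode w) (n : ℕ) :
    evenPart^[n] w = evenPart^[n] w' ∨ Move (evenPart^[n] w) (evenPart^[n] w') := by
  induction n with
  | zero => exact .inr h
  | succ n ih =>
    rw [Function.iterate_succ_apply', Function.iterate_succ_apply']
    rcases ih with h | h
    · exact .inl (congrArg _ h)
    · exact (parityInvariant_move h (hw.iterate_evenPart n)).1

theorem Equivalent.coloring_evenPart (B : Biquandle X) {D E : GaussDiagram} (h : Equivalent D E)
    (n : ℕ) : Nonempty (B.Coloring (evenPart^[n] D.code) ≃ B.Coloring (evenPart^[n] E.code)) := by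
  induction h with
  | rel D E h =>
    rcases iterate_evenPart_move h D.valid n with h' | h'
    · rw [h']
      exact ⟨Equiv.refl _⟩
    · exact B.coloring_move h' (D.valid.iterate_evenPart n)
  | refl => exact ⟨Equiv.refl _⟩
  | symm _ _ _ ih => exact ih.map Equiv.symm
  | trans _ _ _ _ _ ih ih' => exact ih.map2 Equiv.trans ih'

theorem KnotColorable.oddWrithe_eq_zero {D : GaussDiagram} (h : KnotColorable D) :
    oddWrithe D = 0 := by
  obtain ⟨E, hE, hc⟩ := h
  rw [hE.oddWrithe_eq, oddWrithe_eq_oddSum]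
  exact oddSum_eq_zero fun x hx => hc.not_isOddAt hx

/-- A checkerboard colorable virtual knot has as many colorings as the code that is left
over after odd crossings have been removed repeatedly. -/
theorem KnotColorable.coloring (B : Biquandle X) {D : GaussDiagram} (h : KnotColorable D)
    (n : ℕ) : Nonempty (B.Coloring D.code ≃ B.Coloring (evenPart^[n] D.code)) := by
  obtain ⟨E, hE, hc⟩ := h
  have e := hE.coloring_evenPart B n
  -- The colorable representative `E` has no odd crossings, so deletion does nothing to it; it links
  -- the colorings of `D` with those of its reduced code.
  rw [Function.iterate_fixed (evenPart_eq_self fun x hx => hc.not_isOddAt hx)] at e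
  exact (hE.coloring B).map2 (fun f g => f.trans g.symm) e

namespace Biquandle

variable (B : Biquandle X)

instance [DecidableEq X] (f : ℕ → X × X) (p : X) (w : List Passage) (q : X) :
    Decidable (B.Path f p w q) := by
  induction w generalizing p with
  | nil => exact inferInstanceAs (Decidable (p = q))
  | cons x w ih => exact @instDecidableAnd _ _ _ (ih _)

/-- The states of the crossings `1, 2, …`, given by a list. -/
def states (s : List (X × X)) : ℕ → X × X
  | 0 => default
  | l + 1 => s.getD l default

/-- Recording the color at the base point is what makes this correct: without crossings it is the
only freedom. -/
theorem coloring_nil_equiv : Nonempty (B.Coloring [] ≃ X) :=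
  ⟨⟨fun c => c.1.2, fun p => ⟨(fun _ => default, p), fun _ _ => rfl, rfl⟩, fun c =>
    Subtype.ext (Prod.ext (funext fun l => (c.2.1 l (by simp [Fresh])).symm) rfl), fun _ => rfl⟩⟩

/-- The coloring with the given states of the crossings `1, …, n`. -/
def coloringOfStates {w : List Passage} {s : List (X × X)} {p : X}
    (hw : ∀ l < s.length, l + 1 ∈ crossings w) (hp : B.Path (states s) p w p) : B.Coloring w :=
  ⟨(states s, p), fun l hl => by
    cases l with
    | zero => rfl
    | succ l =>
      refine List.getD_eq_default _ _ (le_of_not_gt fun h => ?_)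
      have := hw l h
      simp only [crossings, List.mem_toFinset, List.mem_map] at this
      obtain ⟨x, hx, hx'⟩ := this
      exact hl x hx hx', hp⟩

/-- If the knot were colorable, it would have as many colorings as the code without crossings,
namely `Fintype.card X`; the list `L` contains more. -/
theorem not_knotColorable_of_colorings [Fintype X] {D : GaussDiagram} {k n : ℕ}
    (hD : evenPart^[k] D.code = []) (L : List (X × List (X × X))) (hL : L.Nodup) (hc : Fintype.card X < L.length)
    (hn : ∀ l < n, l + 1 ∈ crossings D.code)
    (h : ∀ c ∈ L, c.2.length = n ∧ B.Path (states c.2) c.1 D.code c.1) : ¬ KnotColorable D := by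
  classical
  intro hk
  have e := hk.coloring B k
  rw [hD] at e
  obtain ⟨e⟩ := e.map2 Equiv.trans B.coloring_nil_equiv
  let F : {c // c ∈ L} → X := fun c =>
    e (B.coloringOfStates (s := c.1.2) (p := c.1.1) (by rw [(h _ c.2).1]; exact hn) (h _ c.2).2)
  have hF : Function.Injective F := by
    rintro ⟨⟨p, s⟩, hs⟩ ⟨⟨p', s'⟩, hs'⟩ heq
    have h1 := congrArg Subtype.val (e.injective heq)
    simp only [coloringOfStates, Prod.mk.injEq] at h1
    obtain ⟨h1, rfl⟩ := h1
    have : s = s' := by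
      have hl := (h _ hs).1
      have hl' := (h _ hs').1
      dsimp only at hl hl'
      refine List.ext_getElem (hl.trans hl'.symm) fun i hi hi' => ?_
      have := congrFun h1 (i + 1)
      simpa only [states, List.getD_eq_getElem _ _ hi, List.getD_eq_getElem _ _ hi'] using this
    subst this
    rfl
  have hcard := Fintype.card_le_of_injective F hF
  rw [Fintype.card_of_subtype L.toFinset (fun x => List.mem_toFinset),
    List.toFinset_card_of_nodup hL] at hcard
  omega

/-- Here the comparison fails in the other direction: the reduced code has a coloring and the
diagram has none. -/
theorem not_knotColorable_of_isEmpty {D : GaussDiagram} (h : ∀ f p, ¬ B.Path f p D.code p)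
    {k : ℕ} {s : List (X × X)} {p : X} (hs : B.Path (states s) p (evenPart^[k] D.code) p) : ¬ KnotColorable D := by
  intro hk
  obtain ⟨e⟩ := hk.coloring B k
  have : ∃ f : ℕ → X × X, (∀ l, Fresh l (evenPart^[k] D.code) → f l = default) ∧
      B.Path f p (evenPart^[k] D.code) p := by
    classical
    refine ⟨fun l => if Fresh l (evenPart^[k] D.code) then default else states s l,
      fun l hl => if_pos hl, (path_congr fun x hx => ?_).2 hs⟩
    exact if_neg fun hf => hf x hx rfl
  obtain ⟨f, hf⟩ := this
  have c := e.symm ⟨(f, p), hf⟩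
  exact h _ _ c.2.2

end Biquandle

/-! ### Explicit colorings and odd writhes of the individual knots -/

theorem not_knotColorable_knot4_55 : ¬ KnotColorable knot4_55 :=
  Biquandle.biquandle4.not_knotColorable_of_colorings (k := 2) (n := 4) (by decide)
    [(0, [(0, 0), (0, 0), (0, 0), (0, 0)]),
      (0, [(0, 0), (0, 0), (0, 2), (0, 2)]),
      (0, [(0, 1), (1, 2), (1, 0), (2, 1)]),
      (0, [(0, 1), (1, 2), (1, 2), (2, 3)]),
      (1, [(1, 2), (0, 1), (2, 1), (1, 0)])]
    (by decide) (by decide) (by decide) (by decide +kernel)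

theorem not_knotColorable_knot4_56 : ¬ KnotColorable knot4_56 :=
  Biquandle.biquandle4.not_knotColorable_of_colorings (k := 2) (n := 4) (by decide)
    [(0, [(0, 0), (0, 0), (0, 0), (0, 0)]),
      (0, [(0, 0), (0, 0), (1, 3), (1, 3)]),
      (0, [(0, 1), (1, 2), (0, 3), (2, 3)]),
      (0, [(0, 1), (1, 2), (1, 0), (3, 0)]),
      (1, [(1, 2), (0, 1), (2, 3), (0, 3)])]
    (by decide) (by decide) (by decide) (by decide +kernel)

/-- Here two deletions are really needed: the first removes the crossings 1 and 4, and only then do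
2 and 3 become odd. Ten colorings are listed against nine elements. -/
theorem not_knotColorable_knot4_59 : ¬ KnotColorable knot4_59 :=
  Biquandle.biquandle9.not_knotColorable_of_colorings (k := 2) (n := 4) (by decide)
    [(0, [(0, 0), (0, 0), (0, 0), (0, 0)]),
      (0, [(0, 4), (1, 3), (1, 3), (0, 4)]),
      (0, [(0, 8), (2, 6), (2, 6), (0, 8)]),
      (1, [(1, 2), (3, 7), (3, 7), (1, 2)]),
      (1, [(1, 3), (4, 1), (4, 1), (1, 3)]),
      (1, [(1, 7), (5, 4), (5, 4), (1, 7)]),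
      (2, [(2, 1), (6, 5), (6, 5), (2, 1)]),
      (2, [(2, 5), (7, 8), (7, 8), (2, 5)]),
      (2, [(2, 6), (8, 2), (8, 2), (2, 6)]),
      (3, [(3, 0), (7, 6), (7, 6), (3, 0)])]
    (by decide) (by decide) (by decide) (by decide +kernel)

theorem not_knotColorable_knot4_76 : ¬ KnotColorable knot4_76 :=
  Biquandle.biquandle4.not_knotColorable_of_colorings (k := 2) (n := 4) (by decide)
    [(0, [(0, 0), (0, 0), (0, 0), (0, 0)]),
      (0, [(0, 0), (0, 0), (3, 1), (3, 1)]),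
      (0, [(0, 1), (1, 2), (0, 1), (0, 3)]),
      (0, [(0, 1), (1, 2), (3, 0), (3, 2)]),
      (1, [(1, 2), (0, 1), (0, 3), (0, 1)])]
    (by decide) (by decide) (by decide) (by decide +kernel)

theorem not_knotColorable_knot4_77 : ¬ KnotColorable knot4_77 :=
  Biquandle.biquandle4.not_knotColorable_of_colorings (k := 2) (n := 4) (by decide)
    [(0, [(0, 0), (0, 0), (0, 0), (0, 0)]),
      (0, [(0, 0), (0, 0), (2, 0), (2, 0)]),
      (0, [(0, 1), (1, 2), (0, 1), (1, 2)]),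
      (0, [(0, 1), (1, 2), (2, 1), (3, 2)]),
      (1, [(1, 2), (0, 1), (1, 2), (0, 1)])]
    (by decide) (by decide) (by decide) (by decide +kernel)

open Biquandle in
theorem not_knotColorable_knot4_93 : ¬ KnotColorable knot4_93 := by
  -- The path conditions along the code, stated for the four states that matter. Each equation comes
  -- as early as its states are available, which cuts down the exhaustive search.
  have key : ∀ p : Fin 4, ∀ z1 : Fin 4 × Fin 4, biquandle4'.upper true z1 = p →
      ∀ z2 : Fin 4 × Fin 4, biquandle4'.upper true z2 = biquandle4'.upper false z1 →
      ∀ z3 : Fin 4 × Fin 4, biquandle4'.upper true z3 = biquandle4'.upper false z2 →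
      ∀ z4 : Fin 4 × Fin 4, biquandle4'.upper false z4 = biquandle4'.upper false z3 →
      biquandle4'.lower true z1 = biquandle4'.upper true z4 →
      biquandle4'.lower true z3 = biquandle4'.lower false z1 →
      biquandle4'.lower true z2 = biquandle4'.lower false z3 →
      biquandle4'.lower false z4 = biquandle4'.lower false z2 → biquandle4'.lower true z4 ≠ p := by
    decide +kernel
  -- The crossings 1 and 4 are odd; the remaining code O2 O3 U3 U2 consists of nested kinks and has
  -- the coloring given by `s`. Its entries for 1 and 4 play no role.
  refine biquandle4'.not_knotColorable_of_isEmpty (fun f p h => ?_) (k := 1) (p := 0)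
    (s := [(0, 0), (0, 0), (1, 1), (0, 0)]) (by decide)
  obtain ⟨h1, h2, h3, h4, h5, h6, h7, h8, h9⟩ := h
  exact key p (f 1) h1 (f 2) h2 (f 3) h3 (f 4) h4 h5 h6 h7 h8 h9

open Biquandle in
theorem not_knotColorable_knot4_96 : ¬ KnotColorable knot4_96 := by
  have key : ∀ p : Fin 4, ∀ z1 : Fin 4 × Fin 4, biquandle4'.upper true z1 = p →
      ∀ z2 : Fin 4 × Fin 4, biquandle4'.upper true z2 = biquandle4'.upper false z1 →
      ∀ z3 : Fin 4 × Fin 4, biquandle4'.lower false z3 = biquandle4'.upper false z2 →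
      biquandle4'.lower true z1 = biquandle4'.lower true z3 → ∀ z4 : Fin 4 × Fin 4,
      biquandle4'.upper true z4 = biquandle4'.lower false z1 →
      biquandle4'.lower true z2 = biquandle4'.upper false z4 →
      biquandle4'.upper false z3 = biquandle4'.lower false z2 →
      biquandle4'.lower true z4 = biquandle4'.upper true z3 → biquandle4'.lower false z4 ≠ p := by
    decide +kernel
  -- Here 2 and 3 are odd, and two successive kinks O1 U1 O4 U4 are left.
  refine biquandle4'.not_knotColorable_of_isEmpty (fun f p h => ?_) (k := 1) (p := 0)
    (s := [(0, 0), (0, 0), (0, 0), (0, 0)]) (by decide)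
  obtain ⟨h1, h2, h3, h4, h5, h6, h7, h8, h9⟩ := h
  exact key p (f 1) h1 (f 2) h2 (f 3) h3 h4 (f 4) h5 h6 h7 h8 h9

theorem oddWrithe_ne_zero_of_mem : ∀ D ∈ oddWritheKnots, oddWrithe D ≠ 0 := by
  decide +kernel

theorem oddWrithe_knot4_72 : oddWrithe knot4_72 = 0 := by
  decide

end VirtualKnot

namespace VirtualKnot

/-! ### Arrow polynomials -/

theorem A_zero : A 0 = 1 := by simp [A]

theorem A_mul_A (k l : ℤ) : A k * A l = A (k + l) := by
  rw [A, A, A, ← map_mul, LaurentPolynomial.T_add]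

theorem A_mul_loopValue (k : ℤ) : A k * loopValue = -A (k + 2) - A (k - 2) := by
  have h1 := A_mul_A k 2
  have h2 := A_mul_A k (-2)
  rw [loopValue, sub_eq_add_neg k]
  linear_combination -h1 - h2

theorem loopValue_sq : loopValue ^ 2 = A 4 + 2 + A (-4) := by
  have h := A_mul_loopValue 2
  have h' := A_mul_loopValue (-2)
  norm_num [A_zero] at h h'
  rw [loopValue] at *
  linear_combination -h - h'

theorem K_zero : K 0 = 1 := by simp [K]

/-- For every state of the diagram, the exponent `α - β` and the indices of the state circles. -/
def stateData (D : GaussDiagram) : Multiset (ℤ × Multiset ℕ) :=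
  (crossings D.code).powerset.val.map fun S =>
    ((S.card : ℤ) - ((crossings D.code \ S).card : ℤ), (stateCircles D.code S).val.map Prod.snd)

/-- Separates the combinatorics of the states, which is decidable, from the arithmetic in the
polynomial ring, which is not computable. -/
theorem arrowPolynomial_eq_sum (D : GaussDiagram) :
    arrowPolynomial D = ((stateData D).map fun q =>
      A q.1 * loopValue ^ (q.2.card - 1) * (q.2.map K).prod).sum := by
  simp only [arrowPolynomial, stateData, Multiset.map_map, Finset.sum, Finset.prod, Function.comp_def,
    Multiset.card_map, Finset.card_val]

theorem stateData_knot4_55 : stateData knot4_55 =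
    {(-4, {0}), (-2, {1, 1}), (-2, {1}), (-2, {1, 1}), (-2, {1}),
      (0, {2}), (0, {0, 1, 1}), (0, {0, 1}), (0, {0, 1}), (0, {0}),
      (0, {2}), (2, {1, 1}), (2, {1}), (2, {1, 1}), (2, {1}),
      (4, {0})} := by
  decide +kernel

theorem arrowPolynomial_knot4_55 : arrowPolynomial knot4_55 =
    A 4 + A (-4) + 1 - (A 4 + A (-4) + 2) * K 1 ^ 2 + 2 * K 2 := by
  rw [arrowPolynomial_eq_sum, stateData_knot4_55]
  simp only [Multiset.insert_eq_cons, Multiset.map_cons, Multiset.map_singleton, Multiset.sum_cons,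
    Multiset.sum_singleton, Multiset.card_cons, Multiset.card_singleton, Multiset.prod_cons,
    Multiset.prod_singleton, Nat.reduceAdd, Nat.reduceSub, pow_zero, pow_one, mul_one,
    A_mul_loopValue, K_zero, Int.reduceAdd, Int.reduceSub, Int.reduceNeg, A_zero, loopValue_sq]
  rw [loopValue]
  ring

theorem stateData_knot4_56 : stateData knot4_56 =
    {(-4, {0}), (-2, {1, 1}), (-2, {1}), (-2, {1}), (-2, {1, 1}),
      (0, {2}), (0, {0, 1}), (0, {0, 1, 1}), (0, {0}), (0, {0, 1}),
      (0, {2}), (2, {1}), (2, {1, 1}), (2, {1, 1}), (2, {1}),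
      (4, {0})} := by
  decide +kernel

theorem arrowPolynomial_knot4_56 : arrowPolynomial knot4_56 =
    A 4 + A (-4) + 1 - (A 4 + A (-4) + 2) * K 1 ^ 2 + 2 * K 2 := by
  rw [arrowPolynomial_eq_sum, stateData_knot4_56]
  simp only [Multiset.insert_eq_cons, Multiset.map_cons, Multiset.map_singleton, Multiset.sum_cons,
    Multiset.sum_singleton, Multiset.card_cons, Multiset.card_singleton, Multiset.prod_cons,
    Multiset.prod_singleton, Nat.reduceAdd, Nat.reduceSub, pow_zero, pow_one, mul_one,
    A_mul_loopValue, K_zero, Int.reduceAdd, Int.reduceSub, Int.reduceNeg, A_zero, loopValue_sq]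
  rw [loopValue]
  ring

theorem stateData_knot4_59 : stateData knot4_59 =
    {(-4, {2}), (-2, {1}), (-2, {1}), (-2, {1, 1}), (-2, {1}),
      (0, {0, 1}), (0, {0}), (0, {0, 1}), (0, {0, 1}), (0, {0}),
      (0, {0}), (2, {1}), (2, {1}), (2, {1, 1}), (2, {1}),
      (4, {2})} := by
  decide +kernel

theorem arrowPolynomial_knot4_59 : arrowPolynomial knot4_59 =
    3 - (A 4 + A (-4) + 2) * K 1 ^ 2 + (A 4 + A (-4)) * K 2 := by
  rw [arrowPolynomial_eq_sum, stateData_knot4_59]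
  simp only [Multiset.insert_eq_cons, Multiset.map_cons, Multiset.map_singleton, Multiset.sum_cons,
    Multiset.sum_singleton, Multiset.card_cons, Multiset.card_singleton, Multiset.prod_cons,
    Multiset.prod_singleton, Nat.reduceAdd, Nat.reduceSub, pow_zero, pow_one, mul_one,
    A_mul_loopValue, K_zero, Int.reduceAdd, Int.reduceSub, Int.reduceNeg, A_zero]
  rw [loopValue]
  ring

theorem stateData_knot4_72 : stateData knot4_72 =
    {(-4, {0}), (-2, {1}), (-2, {1}), (-2, {1}), (-2, {0, 0}),
      (0, {0, 1}), (0, {0, 1}), (0, {0}), (0, {0}), (0, {0, 1}),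
      (0, {0}), (2, {1}), (2, {1}), (2, {0, 0}), (2, {1}),
      (4, {0})} := by
  decide +kernel

theorem arrowPolynomial_knot4_72 : arrowPolynomial knot4_72 =
    1 := by
  rw [arrowPolynomial_eq_sum, stateData_knot4_72]
  simp only [Multiset.insert_eq_cons, Multiset.map_cons, Multiset.map_singleton, Multiset.sum_cons,
    Multiset.sum_singleton, Multiset.card_cons, Multiset.card_singleton, Multiset.prod_cons,
    Multiset.prod_singleton, Nat.reduceAdd, Nat.reduceSub, pow_zero, pow_one, mul_one,
    A_mul_loopValue, K_zero, Int.reduceAdd, Int.reduceSub, Int.reduceNeg, A_zero]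
  rw [loopValue]
  ring

theorem stateData_knot4_76 : stateData knot4_76 =
    {(-4, {2}), (-2, {1, 1}), (-2, {1}), (-2, {1, 1}), (-2, {1}),
      (0, {0}), (0, {0, 1, 1}), (0, {0, 1}), (0, {0, 1}), (0, {0}),
      (0, {0}), (2, {1, 1}), (2, {1}), (2, {1, 1}), (2, {1}),
      (4, {2})} := by
  decide +kernel

theorem arrowPolynomial_knot4_76 : arrowPolynomial knot4_76 =
    3 - (A 4 + A (-4) + 2) * K 1 ^ 2 + (A 4 + A (-4)) * K 2 := by
  rw [arrowPolynomial_eq_sum, stateData_knot4_76]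
  simp only [Multiset.insert_eq_cons, Multiset.map_cons, Multiset.map_singleton, Multiset.sum_cons,
    Multiset.sum_singleton, Multiset.card_cons, Multiset.card_singleton, Multiset.prod_cons,
    Multiset.prod_singleton, Nat.reduceAdd, Nat.reduceSub, pow_zero, pow_one, mul_one,
    A_mul_loopValue, K_zero, Int.reduceAdd, Int.reduceSub, Int.reduceNeg, A_zero, loopValue_sq]
  rw [loopValue]
  ring

theorem stateData_knot4_77 : stateData knot4_77 =
    {(-4, {2}), (-2, {1, 1}), (-2, {1}), (-2, {1}), (-2, {1, 1}),
      (0, {0}), (0, {0, 1}), (0, {0, 1, 1}), (0, {0}), (0, {0, 1}),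
      (0, {0}), (2, {1}), (2, {1, 1}), (2, {1, 1}), (2, {1}),
      (4, {2})} := by
  decide +kernel

theorem arrowPolynomial_knot4_77 : arrowPolynomial knot4_77 =
    3 - (A 4 + A (-4) + 2) * K 1 ^ 2 + (A 4 + A (-4)) * K 2 := by
  rw [arrowPolynomial_eq_sum, stateData_knot4_77]
  simp only [Multiset.insert_eq_cons, Multiset.map_cons, Multiset.map_singleton, Multiset.sum_cons,
    Multiset.sum_singleton, Multiset.card_cons, Multiset.card_singleton, Multiset.prod_cons,
    Multiset.prod_singleton, Nat.reduceAdd, Nat.reduceSub, pow_zero, pow_one, mul_one,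
    A_mul_loopValue, K_zero, Int.reduceAdd, Int.reduceSub, Int.reduceNeg, A_zero, loopValue_sq]
  rw [loopValue]
  ring

theorem stateData_knot4_93 : stateData knot4_93 =
    {(-4, {0, 0}), (-2, {0, 1, 1}), (-2, {0}), (-2, {0}), (-2, {0, 0, 0}),
      (0, {1, 1}), (0, {1, 1}), (0, {0, 0}), (0, {1}), (0, {0, 0}),
      (0, {0, 0}), (2, {1, 2}), (2, {0}), (2, {0}), (2, {0}),
      (4, {3})} := by
  decide +kernel

theorem arrowPolynomial_knot4_93 : arrowPolynomial knot4_93 =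
    K 1 ^ 2 * A (-6) + A 4 * (K 3 - K 1 * K 2) - A 2 * (K 1 ^ 2 - 1) - K 1 * K 2 + K 1 := by
  rw [arrowPolynomial_eq_sum, stateData_knot4_93]
  simp only [Multiset.insert_eq_cons, Multiset.map_cons, Multiset.map_singleton, Multiset.sum_cons,
    Multiset.sum_singleton, Multiset.card_cons, Multiset.card_singleton, Multiset.prod_cons,
    Multiset.prod_singleton, Nat.reduceAdd, Nat.reduceSub, pow_zero, pow_one, mul_one,
    A_mul_loopValue, K_zero, Int.reduceAdd, Int.reduceSub, Int.reduceNeg, A_zero, loopValue_sq]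
  rw [loopValue]
  -- The states with three circles contribute `A (-2) * loopValue ^ 2`, whose expansion leaves these
  -- two products for the final combination.
  have h : A (-2) * A 4 = A 2 := A_mul_A _ _
  have h' : A (-2) * A (-4) = A (-6) := A_mul_A _ _
  linear_combination (1 + K 1 ^ 2) * (h + h')

theorem stateData_knot4_96 : stateData knot4_96 =
    {(-4, {0, 0}), (-2, {0}), (-2, {0, 1, 1}), (-2, {0, 0, 0}), (-2, {0}),
      (0, {1, 1}), (0, {0, 0}), (0, {1}), (0, {0, 0}), (0, {1, 1}),
      (0, {0, 0}), (2, {0}), (2, {0, 1}), (2, {0}), (2, {0}),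
      (4, {1})} := by
  decide +kernel

theorem arrowPolynomial_knot4_96 : arrowPolynomial knot4_96 =
    A (-6) * K 1 ^ 2 + A 2 - A 2 * K 1 ^ 2 := by
  rw [arrowPolynomial_eq_sum, stateData_knot4_96]
  simp only [Multiset.insert_eq_cons, Multiset.map_cons, Multiset.map_singleton, Multiset.sum_cons,
    Multiset.sum_singleton, Multiset.card_cons, Multiset.card_singleton, Multiset.prod_cons,
    Multiset.prod_singleton, Nat.reduceAdd, Nat.reduceSub, pow_zero, pow_one, mul_one,
    A_mul_loopValue, K_zero, Int.reduceAdd, Int.reduceSub, Int.reduceNeg, A_zero, loopValue_sq]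
  rw [loopValue]
  have h : A (-2) * A 4 = A 2 := A_mul_A _ _
  have h' : A (-2) * A (-4) = A (-6) := A_mul_A _ _
  linear_combination (1 + K 1 ^ 2) * (h + h')

end VirtualKnot

namespace VirtualKnot

/-! ### The conditions on the summands -/

theorem kDegree_single (i : ℕ+) : kDegree (Finsupp.single i 1) = i := by
  simp [kDegree]

/-- Every monomial of `K 1 * q` contains `K 1`, so nothing in it can meet the monomial `K i`. The
`k`-degree of that monomial is `i`, which is less than `2 * i` and thus violates the index bound. -/
theorem coeff_linear {p q : ArrowRing} {a c : LaurentPolynomial ℤ} {i : ℕ+} (hi : i ≠ 1)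
    (h : p = MvPolynomial.C a + K 1 * q + MvPolynomial.C c * K i) :
    p.coeff (Finsupp.single i 1) = c := by
  have h1 : K 1 = MvPolynomial.X 1 := by simp [K]
  have h2 : K i = MvPolynomial.X i := by rw [K, dif_pos i.pos]; rfl
  have h3 : (0 : ℕ+ →₀ ℕ) ≠ Finsupp.single i 1 := by simp [eq_comm]
  rw [h, h1, h2, MvPolynomial.coeff_add, MvPolynomial.coeff_add, MvPolynomial.coeff_C, if_neg h3,
    MvPolynomial.coeff_X_mul', if_neg (by simpa [Finsupp.single_apply] using hi.symm),
    MvPolynomial.coeff_C_mul, MvPolynomial.coeff_X]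
  simp

theorem not_largestIndexBound_of_linear {p q : ArrowRing} {a c : LaurentPolynomial ℤ} {i : ℕ+}
    (hi : i ≠ 1) (hc : c ≠ 0) (h : p = MvPolynomial.C a + K 1 * q + MvPolynomial.C c * K i) :
    ¬ LargestIndexBound p := by
  intro hp
  have := hp _ (by rw [MvPolynomial.mem_support_iff, coeff_linear hi h]; exact hc) i (by simp)
  rw [kDegree_single] at this
  have := i.pos
  omega

theorem not_evenKDegrees_of_linear {p q : ArrowRing} {a c : LaurentPolynomial ℤ} {i : ℕ+}
    (hi : i ≠ 1) (hc : c ≠ 0) (h : p = MvPolynomial.C a + K 1 * q + MvPolynomial.C c * K i)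
    (ho : Odd (i : ℕ)) : ¬ EvenKDegrees p := by
  intro hp
  have := hp _ (by rw [MvPolynomial.mem_support_iff, coeff_linear hi h]; exact hc)
  rw [kDegree_single] at this
  exact Nat.not_even_iff_odd.2 ho this

theorem support_one_subset {m : ℕ+ →₀ ℕ} (h : m ∈ (1 : ArrowRing).support) : m = 0 := by
  rw [MvPolynomial.mem_support_iff, MvPolynomial.coeff_one] at h
  exact (ite_ne_right_iff.1 h).1.symm

theorem evenKDegrees_one : EvenKDegrees 1 := by
  intro m hm
  rw [support_one_subset hm]
  simp [kDegree]

theorem largestIndexBound_one : LargestIndexBound 1 := by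
  intro m hm
  rw [support_one_subset hm]
  simp

open LaurentPolynomial in
-- Setting `A = 1` gives the integer 2.
theorem T_four_add_T_neg_four_ne_zero : (T 4 + T (-4) : LaurentPolynomial ℤ) ≠ 0 := by
  intro h
  have := congrArg (LaurentPolynomial.eval₂ (RingHom.id ℤ) 1) h
  rw [map_add, eval₂_T, eval₂_T, map_zero, one_zpow, one_zpow] at this
  exact absurd this (by decide)

theorem two_ne_zero_laurent : (2 : LaurentPolynomial ℤ) ≠ 0 := by
  intro h
  have := congrArg (LaurentPolynomial.eval₂ (RingHom.id ℤ) 1) h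
  rw [map_ofNat, map_zero] at this
  exact absurd this (by decide)

/-! ### Normalized arrow polynomials -/

theorem normalizedArrowPolynomial_of_writhe_eq_zero {D : GaussDiagram} (h : writhe D = 0) :
    normalizedArrowPolynomial D = arrowPolynomial D := by
  simp [normalizedArrowPolynomial, h, A_zero]

theorem normalizedArrowPolynomial_of_writhe_eq_neg_two {D : GaussDiagram} (h : writhe D = -2) :
    normalizedArrowPolynomial D = A 6 * arrowPolynomial D := by
  rw [normalizedArrowPolynomial, h]
  norm_num

theorem normalizedArrowPolynomial_knot4_55 : normalizedArrowPolynomial knot4_55 =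
    A 4 + A (-4) + 1 - (A 4 + A (-4) + 2) * K 1 ^ 2 + 2 * K 2 := by
  rw [normalizedArrowPolynomial_of_writhe_eq_zero (by decide), arrowPolynomial_knot4_55]

theorem normalizedArrowPolynomial_knot4_56 : normalizedArrowPolynomial knot4_56 =
    A 4 + A (-4) + 1 - (A 4 + A (-4) + 2) * K 1 ^ 2 + 2 * K 2 := by
  rw [normalizedArrowPolynomial_of_writhe_eq_zero (by decide), arrowPolynomial_knot4_56]

theorem normalizedArrowPolynomial_of_mem : ∀ D ∈ [knot4_59, knot4_76, knot4_77],
    normalizedArrowPolynomial D =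
      3 - (A 4 + A (-4) + 2) * K 1 ^ 2 + (A 4 + A (-4)) * K 2 := by
  intro D hD
  simp only [List.mem_cons, List.not_mem_nil, or_false] at hD
  rcases hD with rfl | rfl | rfl <;>
    rw [normalizedArrowPolynomial_of_writhe_eq_zero (by decide)]
  exacts [arrowPolynomial_knot4_59, arrowPolynomial_knot4_76, arrowPolynomial_knot4_77]

theorem normalizedArrowPolynomial_knot4_72 : normalizedArrowPolynomial knot4_72 = 1 := by
  rw [normalizedArrowPolynomial_of_writhe_eq_zero (by decide), arrowPolynomial_knot4_72]

theorem normalizedArrowPolynomial_knot4_93 : normalizedArrowPolynomial knot4_93 =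
    K 1 ^ 2 + A 10 * (K 3 - K 1 * K 2) - A 8 * (K 1 ^ 2 - 1) - A 6 * (K 1 * K 2 - K 1) := by
  have h1 : A 6 * A (-6) = 1 := (A_mul_A _ _).trans A_zero
  have h2 : A 6 * A 4 = A 10 := A_mul_A _ _
  have h3 : A 6 * A 2 = A 8 := A_mul_A _ _
  rw [normalizedArrowPolynomial_of_writhe_eq_neg_two (by decide), arrowPolynomial_knot4_93]
  linear_combination K 1 ^ 2 * h1 + (K 3 - K 1 * K 2) * h2 - (K 1 ^ 2 - 1) * h3

theorem normalizedArrowPolynomial_knot4_96 : normalizedArrowPolynomial knot4_96 =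
    A 8 - A 8 * K 1 ^ 2 + K 1 ^ 2 := by
  have h1 : A 6 * A (-6) = 1 := (A_mul_A _ _).trans A_zero
  have h3 : A 6 * A 2 = A 8 := A_mul_A _ _
  rw [normalizedArrowPolynomial_of_writhe_eq_neg_two (by decide), arrowPolynomial_knot4_96]
  linear_combination K 1 ^ 2 * h1 + (1 - K 1 ^ 2) * h3

theorem not_largestIndexBound_of_mem : ∀ D ∈ [knot4_55, knot4_56, knot4_59, knot4_76, knot4_77],
    ¬ LargestIndexBound (normalizedArrowPolynomial D) := by
  have e : A 4 + A (-4) = MvPolynomial.C (LaurentPolynomial.T 4 + LaurentPolynomial.T (-4)) :=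
    (map_add MvPolynomial.C _ _).symm
  have e2 : (2 : ArrowRing) = MvPolynomial.C 2 := (map_ofNat MvPolynomial.C 2).symm
  have e3 : (3 : ArrowRing) = MvPolynomial.C 3 := (map_ofNat MvPolynomial.C 3).symm
  have e4 : A 4 + A (-4) + 1 = MvPolynomial.C (LaurentPolynomial.T 4 + LaurentPolynomial.T (-4) + 1) := by
    rw [e, map_add MvPolynomial.C _ (1 : LaurentPolynomial ℤ), map_one]
  have h1 : ∀ p : ArrowRing, p = A 4 + A (-4) + 1 - (A 4 + A (-4) + 2) * K 1 ^ 2 + 2 * K 2 →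
      ¬ LargestIndexBound p := fun p hp =>
    not_largestIndexBound_of_linear (a := LaurentPolynomial.T 4 + LaurentPolynomial.T (-4) + 1)
      (q := -((A 4 + A (-4) + 2) * K 1)) (i := 2) (by decide) two_ne_zero_laurent
      (by rw [hp, ← e2, ← e4, PNat.val_ofNat]; ring)
  have h2 : ∀ D ∈ [knot4_59, knot4_76, knot4_77], ¬ LargestIndexBound (normalizedArrowPolynomial D) :=
    fun D hD => not_largestIndexBound_of_linear (a := 3) (q := -((A 4 + A (-4) + 2) * K 1))
      (i := 2) (by decide) T_four_add_T_neg_four_ne_zero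
      (by rw [normalizedArrowPolynomial_of_mem D hD, ← e3, ← e, PNat.val_ofNat]; ring)
  intro D hD
  rcases List.mem_cons.1 hD with rfl | hD
  · exact h1 _ normalizedArrowPolynomial_knot4_55
  rcases List.mem_cons.1 hD with rfl | hD
  · exact h1 _ normalizedArrowPolynomial_knot4_56
  exact h2 D hD

/-- Isolates the summand `A 10 * K 3`. Its `k`-degree 3 is odd and less than 6, so it violates both
conditions. -/
theorem normalizedArrowPolynomial_knot4_93_eq_linear : normalizedArrowPolynomial knot4_93 =
    MvPolynomial.C (LaurentPolynomial.T 8) +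
      K 1 * (K 1 - A 10 * K 2 - A 8 * K 1 - A 6 * (K 2 - 1)) +
      MvPolynomial.C (LaurentPolynomial.T 10) * K (3 : ℕ+) := by
  rw [normalizedArrowPolynomial_knot4_93]
  change _ = A 8 + _ + A 10 * K 3
  ring

end VirtualKnot

open VirtualKnot in
theorem mainTheorem3 :
    -- the six virtual knots are not checkerboard colorable
    (∀ D ∈ [knot4_55, knot4_56, knot4_59, knot4_76, knot4_77, knot4_96], ¬ KnotColorable D) ∧
    -- normalized arrow polynomials
    normalizedArrowPolynomial knot4_55 =
      A 4 + A (-4) + 1 - (A 4 + A (-4) + 2) * K 1 ^ 2 + 2 * K 2 ∧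
    normalizedArrowPolynomial knot4_56 =
      A 4 * (-(K 1 ^ 2 - 1)) + (1 - K 1 ^ 2) * A (-4) - 2 * K 1 ^ 2 + 2 * K 2 + 1 ∧
    (∀ D ∈ [knot4_59, knot4_76, knot4_77], normalizedArrowPolynomial D =
      (A 8 * (K 2 - K 1 ^ 2) + A 4 * (3 - 2 * K 1 ^ 2) - K 1 ^ 2 + K 2) * A (-4)) ∧
    normalizedArrowPolynomial knot4_72 = 1 ∧
    normalizedArrowPolynomial knot4_96 = A 8 - A 8 * K 1 ^ 2 + K 1 ^ 2 ∧
    -- the second condition on the summands fails for five of the six knots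
    (∀ D ∈ [knot4_55, knot4_56, knot4_59, knot4_76, knot4_77],
      ¬ LargestIndexBound (normalizedArrowPolynomial D)) ∧
    -- the knot whose arrow polynomial contains a summand with `K_3`
    arrowPolynomial knot4_93 =
      K 1 ^ 2 * A (-6) + A 4 * (K 3 - K 1 * K 2) - A 2 * (K 1 ^ 2 - 1) - K 1 * K 2 + K 1 ∧
    ¬ EvenKDegrees (normalizedArrowPolynomial knot4_93) ∧
    ¬ LargestIndexBound (normalizedArrowPolynomial knot4_93) ∧
    ¬ KnotColorable knot4_93 ∧
    -- the knots excluded by a nonzero odd writhe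
    (∀ D ∈ oddWritheKnots, (∀ E, Equivalent D E → oddWrithe E ≠ 0) ∧ ¬ KnotColorable D) ∧
    -- neither criterion applies to the knot 4.72
    (∀ E, Equivalent knot4_72 E → oddWrithe E = 0) ∧
    EvenKDegrees (normalizedArrowPolynomial knot4_72) ∧
    LargestIndexBound (normalizedArrowPolynomial knot4_72) := by
  refine ⟨?_, normalizedArrowPolynomial_knot4_55, ?_, ?_, normalizedArrowPolynomial_knot4_72,
    normalizedArrowPolynomial_knot4_96, not_largestIndexBound_of_mem, arrowPolynomial_knot4_93,
    not_evenKDegrees_of_linear (by decide) (LaurentPolynomial.isUnit_T 10).ne_zero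
      normalizedArrowPolynomial_knot4_93_eq_linear (by decide),
    not_largestIndexBound_of_linear (by decide) (LaurentPolynomial.isUnit_T 10).ne_zero
      normalizedArrowPolynomial_knot4_93_eq_linear,
    not_knotColorable_knot4_93, ?_, ?_, ?_, ?_⟩
  · intro D hD
    simp only [List.mem_cons, List.not_mem_nil, or_false] at hD
    rcases hD with rfl | rfl | rfl | rfl | rfl | rfl
    exacts [not_knotColorable_knot4_55, not_knotColorable_knot4_56, not_knotColorable_knot4_59,
      not_knotColorable_knot4_76, not_knotColorable_knot4_77, not_knotColorable_knot4_96]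
  · rw [normalizedArrowPolynomial_knot4_56]
    ring
  · intro D hD
    have h1 : A 8 * A (-4) = A 4 := A_mul_A _ _
    have h2 : A 4 * A (-4) = 1 := (A_mul_A _ _).trans A_zero
    rw [normalizedArrowPolynomial_of_mem D hD]
    linear_combination (K 1 ^ 2 - K 2) * h1 + (2 * K 1 ^ 2 - 3) * h2
  · intro D hD
    have h := oddWrithe_ne_zero_of_mem D hD
    exact ⟨fun E hE => hE.oddWrithe_eq ▸ h, fun hc => h hc.oddWrithe_eq_zero⟩
  · intro E hE
    rw [← hE.oddWrithe_eq, oddWrithe_knot4_72]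
  · rw [normalizedArrowPolynomial_knot4_72]
    exact evenKDegrees_one
  · rw [normalizedArrowPolynomial_knot4_72]
    exact largestIndexBound_one
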